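/- Let $M$ be a smooth (Hausdorff, second countable) $7$-manifold with a closed and co-closed $G_2$-form $\varphi$, i.e. a smooth $3$-form that at each point is identified with the standard form $\varphi_0$ of $\mathbb{R}^7$ by some linear isomorphism $T_mM\cong\mathbb{R}^7$, with $d\varphi=0$ and $d{*}\varphi=0$ (where $*$ is the Hodge star of the metric and orientation determined by $\varphi$). Assume that $b_1(M)=\dim H^1(M,\mathbb{R})=0$ (de Rham cohomology). Let the torus $T^3$ act smoothly on $M$, preserving $\varphi$, with no non-identity element acting trivially. Let $v_1,v_2,v_3$ be any basis of the Lie algebra of $T^3$, let $X_1,X_2,X_3$ be the induced vector fields on $M$, and put $$\sigma_1=i_{X_2}i_{X_3}\varphi,\qquad \sigma_2=i_{X_3}i_{X_1}\varphi,\qquad \sigma_3=i_{X_1}i_{X_2}\varphi .$$ A point $m$ is regular if the differential of the action $v\mapsto X_v(m)$ is injective; let $M'$ be the set of regular points. A coassociative submanifold is an embedded $4$-dimensional submanifold (not necessarily closed) calibrated by $*\varphi$. Then: 1. There are smooth functions $f_1,f_2,f_3$ on $M$ with $df_i=\sigma_i$. 2. $M'$ is open in $M$, and it is dense if $M$ is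 connected. 3. For any smooth functions $f_1,f_2,f_3$ with $df_i=\sigma_i$: each $f_i$ is $T^3$-invariant; and for every $c\in\mathbb{R}^3$ the level set $L_c=\{f_1=c_1,\ f_2=c_2,\ f_3=c_3\}$ is near its regular points a coassociative submanifold, that is, $L_c\cap M'$ (if non-empty) is a coassociative submanifold of $M$, and $\varphi|_{L_c\cap M'}=0$. The level sets $L_c$ are pairwise disjoint and cover $M$; hence $M'$ is covered by the pairwise disjoint coassociative submanifolds $L_c\cap M'$. -/

import Mathlib

open scoped Manifold ContDiff Topology

noncomputable section

/-! ### The model: `ℝ⁷` with its standard `G₂`-form -/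

/-- Euclidean `7`-space. -/
abbrev E7 : Type := EuclideanSpace ℝ (Fin 7)

/-- The linear map `ℝ⁷ → ℝᵏ` selecting the coordinates listed by `s`. -/
def selectCoords {k : ℕ} (s : Fin k → Fin 7) : E7 →L[ℝ] (Fin k → ℝ) :=
  ContinuousLinearMap.pi fun i => EuclideanSpace.proj (s i)

/-- The determinant of `k` vectors of `ℝᵏ`, as a continuous alternating form. -/
def detForm (k : ℕ) : (Fin k → ℝ) [⋀^Fin k]→L[ℝ] ℝ :=
  { (Matrix.detRowAlternating : (Fin k → ℝ) [⋀^Fin k]→ₗ[ℝ] ℝ) with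
    cont := by
      change Continuous fun v : Fin k → Fin k → ℝ => Matrix.det (Matrix.of v)
      exact Continuous.matrix_det continuous_id }

/-- The elementary `k`-form `dx^{s 0} ∧ ⋯ ∧ dx^{s (k-1)}` on `ℝ⁷`, normalised so that its value on
`(v₀, …, v_{k-1})` is the determinant of the matrix `(v_i)_{s j}`. Coordinates are
numbered `0, …, 6`. -/
def dxForm {k : ℕ} (s : Fin k → Fin 7) : E7 [⋀^Fin k]→L[ℝ] ℝ :=
  (detForm k).compContinuousLinearMap (selectCoords s)

theorem dxForm_apply {k : ℕ} (s : Fin k → Fin 7) (v : Fin k → E7) :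
    dxForm s v = Matrix.det (Matrix.of fun i j => v i (s j)) := rfl

/-- The standard `G₂`-form on `ℝ⁷`: with coordinates numbered `1, …, 7`,
`φ₀ = dx¹²³ + dx¹⁴⁵ + dx¹⁶⁷ + dx²⁴⁶ - dx²⁵⁷ - dx³⁴⁷ - dx³⁵⁶`. -/
def phi0 : E7 [⋀^Fin 3]→L[ℝ] ℝ :=
  dxForm ![0, 1, 2] + dxForm ![0, 3, 4] + dxForm ![0, 5, 6] + dxForm ![1, 3, 5]
    - dxForm ![1, 4, 6] - dxForm ![2, 3, 6] - dxForm ![2, 4, 5]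

/-- The Hodge dual of `φ₀` for the Euclidean metric and the standard orientation: with coordinates
numbered `1, …, 7`,
`*φ₀ = dx⁴⁵⁶⁷ + dx²³⁶⁷ + dx²³⁴⁵ + dx¹³⁵⁷ - dx¹³⁴⁶ - dx¹²⁵⁶ - dx¹²⁴⁷`. -/
def starPhi0 : E7 [⋀^Fin 4]→L[ℝ] ℝ :=
  dxForm ![3, 4, 5, 6] + dxForm ![1, 2, 5, 6] + dxForm ![1, 2, 3, 4] + dxForm ![0, 2, 4, 6]
    - dxForm ![0, 2, 3, 5] - dxForm ![0, 1, 4, 5] - dxForm ![0, 1, 3, 6]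

/-! ### Differential forms on a `7`-manifold -/

section Forms

variable (M : Type*) [TopologicalSpace M] [ChartedSpace E7 M]

/-- A (not necessarily continuous) differential `k`-form on `M`: an alternating `k`-form on each
tangent space. -/
def DForm (k : ℕ) : Type _ := ∀ m : M, TangentSpace (𝓡 7) m [⋀^Fin k]→L[ℝ] ℝ

instance (k : ℕ) : AddCommGroup (DForm M k) :=
  inferInstanceAs (AddCommGroup (∀ m : M, TangentSpace (𝓡 7) m [⋀^Fin k]→L[ℝ] ℝ))

instance (k : ℕ) : Module ℝ (DForm M k) :=
  inferInstanceAs (Module ℝ (∀ m : M, TangentSpace (𝓡 7) m [⋀^Fin k]→L[ℝ] ℝ))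

variable {M}

/-- The expression of a differential form in the preferred chart around `x`: the pullback of the
form under the inverse of the chart. Only its values on the target of the chart are meaningful. -/
def DForm.inChart {k : ℕ} (η : DForm M k) (x : M) (y : E7) : E7 [⋀^Fin k]→L[ℝ] ℝ :=
  (η ((extChartAt (𝓡 7) x).symm y)).compContinuousLinearMap
    (mfderiv 𝓘(ℝ, E7) (𝓡 7) (extChartAt (𝓡 7) x).symm y)

/-- A differential form is smooth if all its expressions in charts are. -/
def DForm.IsSmooth {k : ℕ} (η : DForm M k) : Prop :=
  ∀ x : M, ContDiffOn ℝ ∞ (η.inChart x) (extChartAt (𝓡 7) x).target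

/-- A smooth differential form is closed if its exterior derivative vanishes in all charts. -/
def DForm.IsClosed {k : ℕ} (η : DForm M k) : Prop :=
  η.IsSmooth ∧ ∀ x : M, ∀ y ∈ (extChartAt (𝓡 7) x).target, extDeriv (η.inChart x) y = 0

/-- The interior product `i_X η`, that is, `(i_X η)(v₁, …, v_k) = η(X, v₁, …, v_k)`. -/
def DForm.contract {k : ℕ} (X : ∀ m : M, TangentSpace (𝓡 7) m) (η : DForm M (k + 1)) :
    DForm M k :=
  fun m => ContinuousAlternatingMap.curryLeft (E := E7) (η m) (X m)

/-- The differential of a function, as a `1`-form. -/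
def dFun (f : M → ℝ) : DForm M 1 :=
  fun m => ContinuousAlternatingMap.ofSubsingleton ℝ (TangentSpace (𝓡 7) m) ℝ (0 : Fin 1)
    (mfderiv (𝓡 7) 𝓘(ℝ, ℝ) f m)

theorem DForm.inChart_add {k : ℕ} (η θ : DForm M k) (x : M) :
    DForm.inChart (η + θ) x = η.inChart x + θ.inChart x := rfl

theorem DForm.inChart_smul {k : ℕ} (c : ℝ) (η : DForm M k) (x : M) :
    DForm.inChart (c • η) x = c • η.inChart x := rfl

theorem DForm.inChart_zero {k : ℕ} (x : M) :
    DForm.inChart (0 : DForm M k) x = 0 := rfl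

theorem isOpen_target_extChartAt (x : M) : IsOpen (extChartAt (𝓡 7) x).target :=
  _root_.isOpen_extChartAt_target x

theorem DForm.IsSmooth.differentiableAt {k : ℕ} {η : DForm M k} (h : η.IsSmooth) (x : M) {y : E7}
    (hy : y ∈ (extChartAt (𝓡 7) x).target) : DifferentiableAt ℝ (η.inChart x) y :=
  ((h x).contDiffAt ((isOpen_target_extChartAt x).mem_nhds hy)).differentiableAt (by simp)

variable (M)

/-- The space of closed smooth `1`-forms. -/
def closedOneForms : Submodule ℝ (DForm M 1) where
  carrier := {α | DForm.IsClosed α}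
  zero_mem' := by
    refine ⟨fun x => ?_, fun x y _ => ?_⟩
    · rw [DForm.inChart_zero]; exact contDiffOn_const
    · rw [DForm.inChart_zero]
      have h := extDeriv_smul (𝕜 := ℝ) (x := y) (0 : ℝ) (0 : E7 → E7 [⋀^Fin 1]→L[ℝ] ℝ)
      simpa using h
  add_mem' := by
    rintro a b ⟨ha, ha'⟩ ⟨hb, hb'⟩
    refine ⟨fun x => ?_, fun x y hy => ?_⟩
    · rw [DForm.inChart_add]; exact (ha x).add (hb x)
    · rw [DForm.inChart_add, extDeriv_add (ha.differentiableAt x hy) (hb.differentiableAt x hy),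
        ha' x y hy, hb' x y hy, add_zero]
  smul_mem' := by
    rintro c a ⟨ha, ha'⟩
    refine ⟨fun x => ?_, fun x y hy => ?_⟩
    · rw [DForm.inChart_smul]; exact (ha x).const_smul c
    · rw [DForm.inChart_smul, extDeriv_smul, ha' x y hy, smul_zero]

/-- The space of exact `1`-forms `df`, with `f` a smooth function on `M`. -/
def exactOneForms : Submodule ℝ (DForm M 1) where
  carrier := {α | ∃ f : M → ℝ, ContMDiff (𝓡 7) 𝓘(ℝ, ℝ) ∞ f ∧ dFun f = α}
  zero_mem' := by
    refine ⟨fun _ => 0, contMDiff_const, ?_⟩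
    funext m
    ext v
    have h : mfderiv (𝓡 7) 𝓘(ℝ, ℝ) (fun _ : M => (0 : ℝ)) m = 0 := mfderiv_const
    exact congrArg (fun L : TangentSpace (𝓡 7) m →L[ℝ] ℝ => L (v 0)) h
  add_mem' := by
    rintro _ _ ⟨f, hf, rfl⟩ ⟨g, hg, rfl⟩
    refine ⟨f + g, hf.add hg, ?_⟩
    funext m
    have h := mfderiv_add (hf.mdifferentiableAt (x := m) (by simp))
      (hg.mdifferentiableAt (x := m) (by simp))
    ext v
    exact congrArg (fun L : TangentSpace (𝓡 7) m →L[ℝ] ℝ => L (v 0)) h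
  smul_mem' := by
    rintro c _ ⟨f, hf, rfl⟩
    refine ⟨c • f, (contMDiff_const (c := c) (I := 𝓡 7) (I' := 𝓘(ℝ, ℝ)) (n := ∞)).mul hf, ?_⟩
    funext m
    have h := const_smul_mfderiv (hf.mdifferentiableAt (x := m) (by simp)) c
    ext v
    exact congrArg (fun L : TangentSpace (𝓡 7) m →L[ℝ] ℝ => L (v 0)) h

/-- The first de Rham cohomology `H¹(M, ℝ)`: closed `1`-forms modulo exact `1`-forms. -/
abbrev DeRhamH1 : Type _ :=
  closedOneForms M ⧸ (exactOneForms M).comap (closedOneForms M).subtype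

/-- The first Betti number `b₁(M) = dim H¹(M, ℝ)`, as a cardinal number. -/
def firstBetti : Cardinal := Module.rank ℝ (DeRhamH1 M)

end Forms

/-! ### `G₂`-structures -/

section G2

variable {M : Type*} [TopologicalSpace M] [ChartedSpace E7 M]

/-- `σ` identifies `T_m M` with `ℝ⁷` in such a way that `φ₀` corresponds to `φ`. -/
def IsG2Frame (φ : DForm M 3) (m : M) (σ : TangentSpace (𝓡 7) m ≃L[ℝ] E7) : Prop :=
  phi0.compContinuousLinearMap (σ : TangentSpace (𝓡 7) m →L[ℝ] E7) = φ m

/-- A `G₂`-form on `M`: a smooth `3`-form which at each point is equivalent to the standard one. -/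
structure IsG2Form (φ : DForm M 3) : Prop where
  smooth : φ.IsSmooth
  exists_frame : ∀ m : M, ∃ σ : TangentSpace (𝓡 7) m ≃L[ℝ] E7, IsG2Frame φ m σ

/-- A chosen identification of `T_m M` with `ℝ⁷` carrying `φ₀` to `φ`. Two such identifications
differ by an element of the stabiliser `G₂` of `φ₀`, which is contained in `SO(7)`; so the metric
and the Hodge dual defined through it do not depend on the choice. -/
def IsG2Form.frame {φ : DForm M 3} (h : IsG2Form φ) (m : M) : TangentSpace (𝓡 7) m ≃L[ℝ] E7 :=
  (h.exists_frame m).choose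

/-- The Riemannian metric determined by a `G₂`-form. -/
def IsG2Form.metric {φ : DForm M 3} (h : IsG2Form φ) (m : M) (u v : TangentSpace (𝓡 7) m) : ℝ :=
  inner ℝ (h.frame m u) (h.frame m v)

/-- The `4`-form `*φ`, for the metric and orientation determined by the `G₂`-form `φ`. -/
def IsG2Form.star {φ : DForm M 3} (h : IsG2Form φ) : DForm M 4 :=
  fun m => starPhi0.compContinuousLinearMap (h.frame m : TangentSpace (𝓡 7) m →L[ℝ] E7)

/-- A `G₂`-manifold structure: the `G₂`-form is closed and co-closed. -/
structure IsG2Form.IsTorsionFree {φ : DForm M 3} (h : IsG2Form φ) : Prop where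
  closed : φ.IsClosed
  coclosed : h.star.IsClosed

/-! ### Submanifolds and coassociative submanifolds -/

/-- `S` is a smooth embedded `k`-dimensional submanifold of `M` (not necessarily closed in `M`):
around each of its points there is a smooth chart of `M` in which `S` is `ℝᵏ × 0`. -/
def IsEmbeddedSubmanifold (k : ℕ) (S : Set M) : Prop :=
  ∀ p ∈ S, ∃ e ∈ IsManifold.maximalAtlas (𝓡 7) ∞ M, p ∈ e.source ∧
    ∀ q ∈ e.source, (q ∈ S ↔ ∀ j : Fin 7, k ≤ (j : ℕ) → (e q : E7) j = 0)

/-- `v` is tangent to `S` at `p`: it is the velocity at time `0` of a smooth curve through `p`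
which stays in `S` for small times. -/
def IsTangentTo (S : Set M) (p : M) (v : TangentSpace (𝓡 7) p) : Prop :=
  ∃ γ : ℝ → M, ContMDiffAt 𝓘(ℝ, ℝ) (𝓡 7) ∞ γ 0 ∧ γ 0 = p ∧ (∀ᶠ t in 𝓝 (0 : ℝ), γ t ∈ S) ∧
    mfderiv 𝓘(ℝ, ℝ) (𝓡 7) γ 0 (1 : ℝ) = v

/-- `S` is a coassociative submanifold: an embedded `4`-dimensional submanifold calibrated by `*φ`.
Being calibrated means that `*φ` takes the value `±1` on every orthonormal basis of every tangent
space of `S`; then the bases where the value is `1` form an orientation of `S` for which `*φ`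
restricts to the volume form. -/
structure IsG2Form.IsCoassociative {φ : DForm M 3} (h : IsG2Form φ) (S : Set M) : Prop where
  submanifold : IsEmbeddedSubmanifold 4 S
  calibrated : ∀ p ∈ S, ∀ e : Fin 4 → TangentSpace (𝓡 7) p, (∀ i, IsTangentTo S p (e i)) →
    (∀ i j, h.metric p (e i) (e j) = if i = j then 1 else 0) → |h.star p e| = 1

/-! ### Actions of the `3`-torus -/

/-- The `3`-torus, a Lie group. -/
abbrev T3 : Type := Circle × Circle × Circle

/-- The model with corners of the Lie group `T³`. -/
abbrev modelT3 := (𝓡 1).prod ((𝓡 1).prod (𝓡 1))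

/-- The Lie algebra of `T³`. -/
abbrev lieT3 : Type := GroupLieAlgebra modelT3 T3

variable [MulAction T3 M]

/-- The differential at the identity of the orbit map `g ↦ g • m`. -/
def infAction (m : M) : lieT3 →L[ℝ] TangentSpace (𝓡 7) m :=
  mfderiv modelT3 (𝓡 7) (fun g : T3 => g • m) 1

/-- The flow vector field on `M` induced by an element of the Lie algebra of `T³`. -/
def flowField (v : lieT3) (m : M) : TangentSpace (𝓡 7) m := infAction m v

/-- The regular points of the action: those where the differential of the action is injective. -/
def regularPoints (M : Type*) [TopologicalSpace M] [ChartedSpace E7 M] [MulAction T3 M] : Set M :=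
  {m | Function.Injective (infAction m)}

/-- The action preserves the differential form `η`. -/
def PreservesForm {k : ℕ} (η : DForm M k) : Prop :=
  ∀ (g : T3) (m : M),
    (η (g • m)).compContinuousLinearMap (mfderiv (𝓡 7) (𝓡 7) (fun x : M => g • x) m) = η m

/-- The `1`-forms `σ_i = i_{X_{i+1}} i_{X_{i+2}} φ`, indices modulo `3`, where `X_i` is the flow
field of the `i`-th vector of a basis of the Lie algebra. -/
def sigmaForm (φ : DForm M 3) (v : Module.Basis (Fin 3) ℝ lieT3) (i : Fin 3) : DForm M 1 :=
  DForm.contract (flowField (v (i + 1))) (DForm.contract (flowField (v (i + 2))) φ)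

/-- The level set `{f_i = c_i, i = 1, 2, 3}`. -/
def levelSet (f : Fin 3 → M → ℝ) (c : Fin 3 → ℝ) : Set M := {m | ∀ i, f i m = c i}

end G2

end

set_option linter.unusedSectionVars false

noncomputable section

/-! ### Linear algebra of the standard `G₂`-form -/

/-! By Cartan's formula, contracting an invariant closed form with a fundamental field gives a
closed form. The result is again invariant because `T3` is abelian, so two contractions of `φ` give
closed forms `σ_i`. These are exact because `b₁ = 0`.

Let `df = σ_i`. Then `df(X)` is constant along each orbit of the flow of a fundamental field `X`, so
`f` is affine in time there. It is also bounded, since the torus is compact, so `df(X) = 0` and `f`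
is invariant (`contract_dFun_flowField_eq_zero`). In particular `φ(X_1, X_2, X_3) = 0`.

The rest of the geometry is pointwise. If the `X_i` are independent, so are the `σ_i`, which makes a
level set a 4-dimensional submanifold there. Its tangent vectors lie in the common kernel of the
`σ_i`, a 4-space that contains all the `X_i`. Any three vectors from a basis `w, X_1, X_2, X_3` of
it include two of the `X_i`, so `φ` vanishes on the 4-space (`phi0_eq_zero_of_phi0_pair_eq_zero`). A
4-space on which `φ` vanishes is calibrated by `*φ` (`abs_starPhi0_eq_one`).

Openness of the regular set is continuity. For density, a non-regular point is fixed by a nontrivial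
one-parameter subgroup, hence by its closure, which contains an involution. The torus has only
finitely many involutions, and on a connected `M` the fixed set of a nontrivial involution has empty
interior because the action is faithful. So the non-regular points lie in a finite union of closed
sets with empty interior. -/

/-- The cross product of `ℝ⁷` determined by `phi0`. -/
def cross7 (u v : E7) : E7 :=
  let m : Fin 7 → Fin 7 → ℝ := fun i j => u i * v j - u j * v i
  !₂[m 1 2 + m 3 4 + m 5 6, m 2 0 + m 3 5 - m 4 6, m 0 1 - m 3 6 - m 4 5,
    m 4 0 + m 5 1 - m 6 2, m 0 3 - m 6 1 - m 5 2, m 6 0 + m 1 3 - m 2 4, m 0 5 - m 1 4 - m 2 3]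

theorem E7.inner_eq (u v : E7) : inner ℝ u v =
    u 0 * v 0 + u 1 * v 1 + u 2 * v 2 + u 3 * v 3 + u 4 * v 4 + u 5 * v 5 + u 6 * v 6 := by
  simp only [PiLp.inner_apply, Fin.sum_univ_seven, RCLike.inner_apply, conj_trivial]
  ring

theorem phi0_eq_inner_cross7 (u v w : E7) : phi0 ![u, v, w] = inner ℝ (cross7 u v) w := by
  simp only [phi0, cross7, E7.inner_eq, ContinuousAlternatingMap.add_apply,
    ContinuousAlternatingMap.sub_apply, dxForm_apply, Matrix.det_fin_three]
  simp [Matrix.of_apply]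
  ring

theorem inner_cross7_cross7 (u v w : E7) :
    inner ℝ (cross7 u v) (cross7 u w) = inner ℝ u u * inner ℝ v w - inner ℝ u v * inner ℝ u w := by
  simp only [cross7, E7.inner_eq]
  simp
  ring

/-- A polynomial identity in coordinates. On orthonormal vectors the inner-product terms drop out,
so `starPhi0` becomes the pairing of `x × (y × z)` with `w`, up to sign. -/
theorem starPhi0_eq (x y z w : E7) : starPhi0 ![x, y, z, w] =
    - phi0 ![x, cross7 y z, w] + inner ℝ x z * inner ℝ y w - inner ℝ x y * inner ℝ z w := by
  simp only [phi0_eq_inner_cross7]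
  simp only [cross7, E7.inner_eq, starPhi0, ContinuousAlternatingMap.add_apply,
    ContinuousAlternatingMap.sub_apply, dxForm_apply, Matrix.det_succ_row_zero (n := 3),
    Matrix.det_fin_three, Fin.sum_univ_four]
  simp [Matrix.of_apply, Fin.succAbove]
  ring

theorem cross7_self_right (u v : E7) : inner ℝ (cross7 u v) v = 0 := by
  simp only [cross7, E7.inner_eq]; simp; ring

theorem cross7_self_left (u v : E7) : inner ℝ (cross7 u v) u = 0 := by
  simp only [cross7, E7.inner_eq]; simp; ring

theorem inner_cross7_cyclic (u v w : E7) : inner ℝ (cross7 u v) w = inner ℝ (cross7 v w) u := by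
  simp only [cross7, E7.inner_eq]; simp; ring

theorem inner_cross7_swap (u v w : E7) : inner ℝ (cross7 u v) w = - inner ℝ (cross7 v u) w := by
  simp only [cross7, E7.inner_eq]; simp; ring

theorem inner_cross7_cross7_left (u v w : E7) : inner ℝ (cross7 u (cross7 u v)) w =
    inner ℝ u v * inner ℝ u w - inner ℝ u u * inner ℝ v w := by
  rw [inner_cross7_cyclic, inner_cross7_cyclic, inner_cross7_swap, inner_cross7_cross7,
    real_inner_comm v w]
  ring

theorem cross7_anticomm (u v : E7) : cross7 u v = -cross7 v u := by
  refine ext_inner_right ℝ fun w => ?_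
  rw [inner_cross7_swap, inner_neg_left]

/-- An orthonormal `4`-frame on which `phi0` vanishes is calibrated by `starPhi0`. -/
theorem abs_starPhi0_eq_one {e : Fin 4 → E7}
    (he : ∀ i j, inner ℝ (e i) (e j) = if i = j then (1 : ℝ) else 0)
    (hφ : ∀ i j k, phi0 ![e i, e j, e k] = 0) : |starPhi0 e| = 1 := by
  simp only [phi0_eq_inner_cross7] at hφ
  obtain ⟨x, y, z, w, rfl⟩ : ∃ x y z w, e = ![x, y, z, w] :=
    ⟨e 0, e 1, e 2, e 3, by ext i; fin_cases i <;> rfl⟩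
  have hxx : inner ℝ x x = (1 : ℝ) := by simpa using he 0 0
  have hyy : inner ℝ y y = (1 : ℝ) := by simpa using he 1 1
  have hzz : inner ℝ z z = (1 : ℝ) := by simpa using he 2 2
  have hww : inner ℝ w w = (1 : ℝ) := by simpa using he 3 3
  have hxy : inner ℝ x y = (0 : ℝ) := he 0 1
  have hxz : inner ℝ x z = (0 : ℝ) := he 0 2
  have hyz : inner ℝ y z = (0 : ℝ) := he 1 2
  have hyx : inner ℝ y x = (0 : ℝ) := he 1 0
  have hzx : inner ℝ z x = (0 : ℝ) := he 2 0
  have hzy : inner ℝ z y = (0 : ℝ) := he 2 1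
  have hxw : inner ℝ x w = (0 : ℝ) := he 0 3
  have hyw : inner ℝ y w = (0 : ℝ) := he 1 3
  have hzw : inner ℝ z w = (0 : ℝ) := he 2 3
  have hxyz : inner ℝ (cross7 x y) z = (0 : ℝ) := hφ 0 1 2
  have hxzy : inner ℝ (cross7 x z) y = (0 : ℝ) := hφ 0 2 1
  have hyzx : inner ℝ (cross7 y z) x = (0 : ℝ) := hφ 1 2 0
  have hxyw : inner ℝ (cross7 x y) w = (0 : ℝ) := hφ 0 1 3
  have hxzw : inner ℝ (cross7 x z) w = (0 : ℝ) := hφ 0 2 3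
  have hyzw : inner ℝ (cross7 y z) w = (0 : ℝ) := hφ 1 2 3
  -- The vectors `x, y, z, x × y, x × z, y × z, n` will form an orthonormal basis. By hypothesis `w`
  -- is orthogonal to the first six, so Parseval leaves `⟪n, w⟫ ^ 2 = 1`, while `starPhi0` takes the
  -- value `-⟪n, w⟫`.
  set n := cross7 x (cross7 y z) with hn
  have hny : inner ℝ n y = (0 : ℝ) := by
    rw [hn, inner_cross7_cyclic, inner_cross7_cyclic, inner_cross7_cross7, hxz, hyx]
    simp [hyz]
  have hnz : inner ℝ n z = (0 : ℝ) := by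
    rw [hn, inner_cross7_cyclic, inner_cross7_cyclic, cross7_anticomm y z, inner_neg_right,
      inner_cross7_cross7, hxy, hzx]
    simp
  have hBx : inner ℝ x (cross7 y z) = (0 : ℝ) := by rw [real_inner_comm, hyzx]
  have hnA : inner ℝ n (cross7 x y) = (0 : ℝ) := by
    rw [hn, inner_cross7_cross7, hBx, cross7_self_left]; simp
  have hnB : inner ℝ n (cross7 x z) = (0 : ℝ) := by
    rw [hn, inner_cross7_cross7, hBx, cross7_self_right]; simp
  have hnC : inner ℝ n (cross7 y z) = (0 : ℝ) := cross7_self_right _ _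
  have hnn : inner ℝ n n = (1 : ℝ) := by
    rw [hn, inner_cross7_cross7, inner_cross7_cross7, hBx, hxx, hyy, hzz, hyz]; simp
  have hnx : inner ℝ n x = (0 : ℝ) := cross7_self_left _ _
  have hCA : inner ℝ (cross7 y z) (cross7 x y) = (0 : ℝ) := by
    rw [cross7_anticomm x y, inner_neg_right, inner_cross7_cross7, hzx, hyx]; simp
  have hCB : inner ℝ (cross7 y z) (cross7 x z) = (0 : ℝ) := by
    rw [cross7_anticomm x z, cross7_anticomm y z, inner_neg_left, inner_neg_right,
      inner_cross7_cross7, hyx, hzx]; simp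
  have hBA : inner ℝ (cross7 x z) (cross7 x y) = (0 : ℝ) := by
    rw [inner_cross7_cross7, hxz, hzy]; simp
  have hAA : inner ℝ (cross7 x y) (cross7 x y) = (1 : ℝ) := by
    rw [inner_cross7_cross7, hxx, hyy, hxy]; simp
  have hBB : inner ℝ (cross7 x z) (cross7 x z) = (1 : ℝ) := by
    rw [inner_cross7_cross7, hxx, hzz, hxz]; simp
  have hCC : inner ℝ (cross7 y z) (cross7 y z) = (1 : ℝ) := by
    rw [inner_cross7_cross7, hyy, hzz, hyz]; simp
  have hAx := cross7_self_left x y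
  have hAy := cross7_self_right x y
  have hBx := cross7_self_left x z
  have hBz := cross7_self_right x z
  have hCy := cross7_self_left y z
  have hCz := cross7_self_right y z
  have hstar : |starPhi0 ![x, y, z, w]| = |inner ℝ n w| := by
    rw [starPhi0_eq, phi0_eq_inner_cross7, ← hn, hxz, hxy]; simp
  rw [hstar]
  clear_value n
  clear hn
  -- With the products opaque, every entry of the Gram matrix is one of the hypotheses collected
  -- above.
  generalize cross7 x y = A at *
  generalize cross7 x z = B at *
  generalize cross7 y z = C at *
  have hcross : ∀ i j : Fin 7, i ≤ j → inner ℝ ((![x, y, z, A, B, C, n] : Fin 7 → E7) j)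
      ((![x, y, z, A, B, C, n] : Fin 7 → E7) i) = if i = j then (1 : ℝ) else 0 := by
    intro i j hij
    fin_cases i <;> fin_cases j <;> first
      | exact absurd hij (by decide)
      | simp [-inner_self_eq_norm_sq_to_K, *]
  have hb : Orthonormal ℝ (![x, y, z, A, B, C, n] : Fin 7 → E7) := by
    rw [orthonormal_iff_ite]
    intro i j
    rcases le_total i j with h | h
    · rw [real_inner_comm, hcross i j h]
    · rw [hcross j i h]; simp only [eq_comm]
  have hsum := ((basisOfOrthonormalOfCardEqFinrank hb (by simp)).toOrthonormalBasis
    (by simpa using hb)).sum_sq_inner_right w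
  rw [← real_inner_self_eq_norm_sq, hww] at hsum
  simp [Fin.sum_univ_seven, hxw, hyw, hzw, hxyw, hxzw, hyzw] at hsum
  rcases hsum with h | h <;> simp [h]

/-- Since `u × (u × v) = ⟪u, v⟫ u - ⟪u, u⟫ v`, a vanishing product would be a linear relation whose
coefficient `⟪u, u⟫` is nonzero. -/
theorem cross7_ne_zero {u v : E7} (h : LinearIndependent ℝ ![u, v]) : cross7 u v ≠ 0 := by
  intro h0
  have key : inner ℝ u v • u - inner ℝ u u • v = 0 := by
    refine ext_inner_right ℝ fun w => ?_
    have := inner_cross7_cross7_left u v w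
    rw [inner_cross7_cyclic, inner_cross7_cyclic, h0, inner_zero_right] at this
    rw [inner_sub_left, real_inner_smul_left, real_inner_smul_left, inner_zero_left, this]
  have := LinearIndependent.pair_iff.1 h (inner ℝ u v) (-inner ℝ u u) (by
    rw [neg_smul, ← sub_eq_add_neg, key])
  exact h.ne_zero 0 (by simpa using this.2)

/-- Every 2-vector of a 3-space is decomposable: `a` times `a r∧q + b p∧r + c q∧p` equals `(a r - c
p) ∧ (a q - b p)`. If `a ≠ 0`, the two factors are independent, so their cross product cannot
vanish. -/
theorem linearIndependent_phi0_aux {p q r : E7} (h : LinearIndependent ℝ ![p, q, r]) {a b c : ℝ}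
    (h0 : ∀ w, a * phi0 ![r, q, w] + b * phi0 ![p, r, w] + c * phi0 ![q, p, w] = 0) : a = 0 := by
  by_contra ha
  refine cross7_ne_zero (u := a • r - c • p) (v := a • q - b • p) ?_ ?_
  · rw [LinearIndependent.pair_iff]
    intro s t hst
    have := Fintype.linearIndependent_iff.1 h ![-(s * c) - t * b, t * a, s * a] (by
      simp only [Fin.sum_univ_three, ← hst]; simp; module)
    exact ⟨by simpa [ha] using this 2, by simpa [ha] using this 1⟩
  · refine ext_inner_right ℝ fun w => ?_
    have hw := h0 w
    simp only [phi0_eq_inner_cross7] at hw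
    have : inner ℝ (cross7 (a • r - c • p) (a • q - b • p)) w =
        a * (a * inner ℝ (cross7 r q) w + b * inner ℝ (cross7 p r) w
          + c * inner ℝ (cross7 q p) w) := by
      simp only [cross7, E7.inner_eq]; simp; ring
    rw [this, hw, mul_zero, inner_zero_left]

theorem linearIndependent_phi0_pair {x : Fin 3 → E7} (hx : LinearIndependent ℝ x) {a : Fin 3 → ℝ}
    (h : ∀ w, ∑ i, a i * phi0 ![x (i + 2), x (i + 1), w] = 0) : a = 0 := by
  ext i
  refine linearIndependent_phi0_aux (p := x i) (q := x (i + 1)) (r := x (i + 2))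
    (b := a (i + 1)) (c := a (i + 2)) ?_ fun w => ?_
  · convert! hx.comp (fun j => i + j) (add_right_injective i) using 1
    ext j : 1
    fin_cases j <;> simp
  -- The relation is symmetric under cyclic shifts of the indices, so each coefficient can play the
  -- role of `a`.
  · rw [← h w, ← Equiv.sum_comp (Equiv.addLeft i), Fin.sum_univ_three]
    have h1 : i + 2 + 1 = i := by rw [add_assoc]; simp
    have h2 : i + 1 + 2 = i := by rw [add_assoc]; simp
    have h3 : i + 1 + 1 = i + 2 := by rw [add_assoc]; rfl
    have h4 : i + 2 + 2 = i + 1 := by rw [add_assoc]; rfl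
    simp [h1, h2, h3, h4]

/-- A proper subspace of `ι → ℝ` lies in the kernel of a nonzero functional, whose coefficients
would give a nontrivial relation among the components of `L`. -/
theorem surjective_pi_of_forall_sum_eq_zero {V ι : Type*} [AddCommGroup V] [Module ℝ V] [Fintype ι]
    {L : V →ₗ[ℝ] (ι → ℝ)} (h : ∀ a : ι → ℝ, (∀ w, ∑ i, a i * L w i = 0) → a = 0) :
    Function.Surjective L := by
  classical
  rw [← LinearMap.range_eq_top]
  by_contra hne
  obtain ⟨f, hf0, hf⟩ := Submodule.exists_le_ker_of_lt_top _ (lt_top_iff_ne_top.2 hne)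
  refine hf0 (LinearMap.pi_ext' fun i => LinearMap.ext_ring ?_)
  have := h (fun i => f (Pi.single i 1)) fun w => by
    have hw : f (L w) = 0 := hf ⟨w, rfl⟩
    rw [LinearMap.pi_apply_eq_sum_univ f] at hw
    rw [← hw]
    refine Finset.sum_congr rfl fun i _ => ?_
    rw [smul_eq_mul, mul_comm]
    congr 2
    ext j; simp [Pi.single_apply, eq_comm]
  simpa using congrFun this i

/-- If `phi0` vanishes on a linearly independent triple `x`, then it vanishes on the space of all
vectors annihilated by the three covectors `phi0 (x i, x j, ·)`. -/
theorem phi0_eq_zero_of_phi0_pair_eq_zero {x : Fin 3 → E7} (hx : LinearIndependent ℝ x)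
    (hx0 : phi0 ![x 0, x 1, x 2] = 0) {u : Fin 3 → E7}
    (hu : ∀ i j, phi0 ![x (i + 2), x (i + 1), u j] = 0) : phi0 u = 0 := by
  let L : E7 →ₗ[ℝ] (Fin 3 → ℝ) :=
    LinearMap.pi fun i => (innerₛₗ ℝ (cross7 (x (i + 2)) (x (i + 1))) : E7 →ₗ[ℝ] ℝ)
  have hL : ∀ w i, L w i = phi0 ![x (i + 2), x (i + 1), w] := fun w i => by
    rw [phi0_eq_inner_cross7]; rfl
  have hmem : ∀ w, w ∈ LinearMap.ker L ↔ ∀ i, phi0 ![x (i + 2), x (i + 1), w] = 0 := fun w => by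
    simp only [LinearMap.mem_ker, funext_iff, hL, Pi.zero_apply]
  have hsurj : Function.Surjective L := by
    refine surjective_pi_of_forall_sum_eq_zero fun a ha => linearIndependent_phi0_pair hx fun w => ?_
    rw [← ha w]
    simp only [hL]
  have hdim : Module.finrank ℝ (LinearMap.ker L) = 4 := by
    have := LinearMap.finrank_range_add_finrank_ker L
    rw [LinearMap.range_eq_top.2 hsurj, finrank_top] at this
    simp at this
    omega
  have hx012 : ∀ i, phi0 ![x (i + 2), x (i + 1), x i] = 0 := by
    simp only [phi0_eq_inner_cross7] at hx0 ⊢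
    have h1 : inner ℝ (cross7 (x 1) (x 2)) (x 0) = 0 := by rw [← inner_cross7_cyclic, hx0]
    have h2 : inner ℝ (cross7 (x 2) (x 0)) (x 1) = 0 := by rw [← inner_cross7_cyclic, h1]
    intro i
    rw [inner_cross7_swap, neg_eq_zero]
    fin_cases i
    exacts [h1, h2, hx0]
  have hxmem : ∀ j, x j ∈ LinearMap.ker L := fun j => (hmem _).2 fun i => by
    rcases (show j = i ∨ j = i + 1 ∨ j = i + 2 by revert i j; decide) with rfl | rfl | rfl
    · exact hx012 _
    · rw [phi0_eq_inner_cross7, cross7_self_right]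
    · rw [phi0_eq_inner_cross7, cross7_self_left]
  let x' : Fin 3 → LinearMap.ker L := fun j => ⟨x j, hxmem j⟩
  have hx' : LinearIndependent ℝ x' := LinearIndependent.of_comp (LinearMap.ker L).subtype hx
  obtain ⟨w, hw⟩ : ∃ w : LinearMap.ker L, w ∉ Submodule.span ℝ (Set.range x') := by
    by_contra! h
    have h1 := finrank_span_eq_card hx'
    rw [Submodule.eq_top_iff'.2 h, finrank_top, hdim] at h1
    simp at h1
  have hli : LinearIndependent ℝ (Fin.cons w x' : Fin 4 → LinearMap.ker L) :=
    linearIndependent_finCons.2 ⟨hx', hw⟩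
  let b := basisOfLinearIndependentOfCardEqFinrank hli (by simp [hdim])
  -- An alternating form is determined by its values on distinct basis vectors. Three of `w, x 0, x
  -- 1, x 2` always include two of the `x i`, and `x i × x j` is orthogonal to the whole kernel.
  have hzero : (phi0.toAlternatingMap).compLinearMap (LinearMap.ker L).subtype = 0 := by
    refine Module.Basis.ext_alternating b fun v hv => ?_
    have hker : ∀ (z : LinearMap.ker L) i j, inner ℝ (cross7 (x i) (x j)) (z : E7) = 0 := by
      intro z i j
      have hz := (hmem _).1 z.2
      have hsub : ∀ l : Fin 3, l - 1 + 2 = l + 1 := by decide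
      simp only [phi0_eq_inner_cross7] at hz
      rcases (show i = j ∨ (i = j + 1) ∨ (j = i + 1) by revert i j; decide) with rfl | rfl | rfl
      · have := inner_cross7_swap (x i) (x i) z
        linarith
      · have := hz (j - 1)
        rwa [hsub, sub_add_cancel] at this
      · have := hz (i - 1)
        rw [hsub, sub_add_cancel] at this
        rw [inner_cross7_swap, this, neg_zero]
    have hb0 : b 0 = w := by simp [b]
    have hbs : ∀ i : Fin 3, b i.succ = x' i := fun i => by simp [b]
    have hself : ∀ p q : E7, inner ℝ (cross7 p p) q = 0 := fun p q => by
      have := inner_cross7_swap p p q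
      linarith
    have hv : ∀ i j k, inner ℝ (cross7 (b i) (b j)) (b k : E7) = 0 := by
      intro i j k
      induction i using Fin.cases <;> induction j using Fin.cases <;>
        induction k using Fin.cases <;> simp only [hb0, hbs, hself, cross7_self_left,
          cross7_self_right, x', hker]
      · rw [inner_cross7_cyclic, hker]
      · rw [inner_cross7_cyclic, inner_cross7_cyclic, hker]
      · exact hker (x' _) _ _
    have hv' := hv (v 0) (v 1) (v 2)
    rw [← phi0_eq_inner_cross7] at hv'
    rw [AlternatingMap.zero_apply, ← hv']
    change phi0 _ = _
    congr 1
    ext j : 1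
    fin_cases j <;> rfl
  have := congrArg (fun A => A fun j => (⟨u j, (hmem _).2 fun i => hu i j⟩ : LinearMap.ker L)) hzero
  exact this

/-! ### Interior products of invariant closed forms -/

section Cartan

variable {E : Type*} [NormedAddCommGroup E] [NormedSpace ℝ E]

variable (E) in
/-- `ContinuousAlternatingMap.curryLeft` as a continuous linear map. -/
def curryLeftL (k : ℕ) : (E [⋀^Fin (k + 1)]→L[ℝ] ℝ) →L[ℝ] (E →L[ℝ] E [⋀^Fin k]→L[ℝ] ℝ) :=
  (ContinuousAlternatingMap.curryLeftLI (𝕜 := ℝ) (E := E) (F := ℝ)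
    (n := k)).toContinuousLinearMap

@[simp]
theorem curryLeftL_apply {k : ℕ} (A : E [⋀^Fin (k + 1)]→L[ℝ] ℝ) :
    curryLeftL E k A = A.curryLeft := rfl

theorem hasFDerivAt_curryLeft {k : ℕ} (A : E [⋀^Fin (k + 1)]→L[ℝ] ℝ) :
    HasFDerivAt (fun A : E [⋀^Fin (k + 1)]→L[ℝ] ℝ => A.curryLeft) (curryLeftL E k) A := by
  have := ContinuousLinearMap.hasFDerivAt (𝕜 := ℝ) (E := E [⋀^Fin (k + 1)]→L[ℝ] ℝ)
    (F := E →L[ℝ] E [⋀^Fin k]→L[ℝ] ℝ) (curryLeftL E k) (x := A)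
  exact this

theorem contDiff_curryLeft {k : ℕ} :
    ContDiff ℝ ∞ (fun A : E [⋀^Fin (k + 1)]→L[ℝ] ℝ => A.curryLeft) := by
  have := ContinuousLinearMap.contDiff (n := ∞) (𝕜 := ℝ) (E := E [⋀^Fin (k + 1)]→L[ℝ] ℝ)
    (F := E →L[ℝ] E [⋀^Fin k]→L[ℝ] ℝ) (curryLeftL E k)
  exact this

theorem contDiffOn_curryLeft_apply {k : ℕ} {α : E → E [⋀^Fin (k + 1)]→L[ℝ] ℝ} {X : E → E}
    {s : Set E} (hα : ContDiffOn ℝ ∞ α s) (hX : ContDiffOn ℝ ∞ X s) :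
    ContDiffOn ℝ ∞ (fun z => (α z).curryLeft (X z)) s :=
  (contDiff_curryLeft.comp_contDiffOn hα).clm_apply hX

/-- The interior product of a closed form with the generator of a local flow preserving it
is closed. -/
theorem extDeriv_curryLeft_eq_zero {k : ℕ} {α : E → E [⋀^Fin (k + 1)]→L[ℝ] ℝ} {Ψ : ℝ × E → E}
    {X : E → E} {y : E} (hα : DifferentiableAt ℝ α y) (hΨ : ContDiffAt ℝ ∞ Ψ (0, y))
    (hid : ∀ᶠ z in 𝓝 y, Ψ (0, z) = z) (hX : ∀ᶠ z in 𝓝 y, X z = fderiv ℝ Ψ (0, z) (1, 0))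
    (hinv : ∀ᶠ t in 𝓝 (0 : ℝ), (α (Ψ (t, y))).compContinuousLinearMap
      (fderiv ℝ Ψ (t, y) ∘L ContinuousLinearMap.inr ℝ ℝ E) = α y)
    (hclosed : extDeriv α y = 0) :
    extDeriv (fun z => (α z).curryLeft (X z)) y = 0 := by
  have hy : Ψ (0, y) = y := hid.self_of_nhds
  have hD2 : DifferentiableAt ℝ (fderiv ℝ Ψ) (0, y) :=
    (hΨ.fderiv_right (m := 1) (by norm_num; exact ENat.LEInfty.out)).differentiableAt (by simp)
  have hΨ1 : DifferentiableAt ℝ Ψ (0, y) := hΨ.differentiableAt (by simp)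
  set D2 := fderiv ℝ (fderiv ℝ Ψ) (0, y) with hD2def
  -- Symmetry of the mixed second derivatives identifies the time derivative of the spatial
  -- differential of the flow with the differential of `X`.
  have hsymm : ∀ a b, D2 a b = D2 b a := fun a b =>
    hΨ.isSymmSndFDerivAt (by simpa using ENat.LEInfty.out) a b
  have hpair : HasFDerivAt (fun z : E => ((0 : ℝ), z)) (ContinuousLinearMap.inr ℝ ℝ E) y :=
    hasFDerivAt_prodMk_right 0 y
  have hpairt : HasFDerivAt (fun t : ℝ => (t, y)) (ContinuousLinearMap.inl ℝ ℝ E) 0 :=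
    hasFDerivAt_prodMk_left 0 y
  have hXD : HasFDerivAt X ((D2 ∘L ContinuousLinearMap.inr ℝ ℝ E).flip (1, 0)) y := by
    have h := (hD2.hasFDerivAt.comp y hpair).clm_apply (hasFDerivAt_const ((1 : ℝ), (0 : E)) y)
    refine (h.congr_of_eventuallyEq hX).congr_fderiv ?_
    ext v; simp [hD2def]
  have hA0 : ∀ v : E, fderiv ℝ Ψ (0, y) (0, v) = v := by
    intro v
    have h1 := hΨ1.hasFDerivAt.comp y hpair
    have h2 : HasFDerivAt (fun z : E => Ψ (0, z)) (ContinuousLinearMap.id ℝ E) y :=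
      (hasFDerivAt_id y).congr_of_eventuallyEq hid
    have := congrArg (fun L : E →L[ℝ] E => L v) (h1.unique h2)
    simpa using this
  have hXy : X y = fderiv ℝ Ψ (0, y) (1, 0) := hX.self_of_nhds
  -- the Lie derivative
  have hLie : ∀ v : Fin (k + 1) → E, fderiv ℝ α y (X y) v +
      ∑ i, α y (Function.update v i (fderiv ℝ X y (v i))) = 0 := by
    intro v
    have h1 : HasFDerivAt (fun t : ℝ => α (Ψ (t, y)))
        (fderiv ℝ α y ∘L (fderiv ℝ Ψ (0, y) ∘L ContinuousLinearMap.inl ℝ ℝ E)) 0 := by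
      have h : HasFDerivAt α (fderiv ℝ α y) (Ψ (0, y)) := by rw [hy]; exact hα.hasFDerivAt
      exact h.comp (0 : ℝ) (hΨ1.hasFDerivAt.comp (0 : ℝ) hpairt)
    have h2 : ∀ i, HasFDerivAt (fun t : ℝ => fderiv ℝ Ψ (t, y) (0, v i))
        ((D2 ∘L ContinuousLinearMap.inl ℝ ℝ E).flip (0, v i)) 0 := fun i => by
      have h := (hD2.hasFDerivAt.comp (0 : ℝ) hpairt).clm_apply
        (hasFDerivAt_const ((0 : ℝ), v i) (0 : ℝ))
      refine h.congr_fderiv ?_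
      ext; simp [hD2def]
    have h3 := h1.continuousAlternatingMap_apply h2
    have h4 : HasFDerivAt (fun t : ℝ => α (Ψ (t, y)) (fun i => fderiv ℝ Ψ (t, y) (0, v i)))
        (0 : ℝ →L[ℝ] ℝ) 0 := by
      refine (hasFDerivAt_const (α y v) (0 : ℝ)).congr_of_eventuallyEq (hinv.mono fun t ht => ?_)
      have := congrArg (fun A => A v) ht
      simpa [Function.comp_def] using this
    have h5 := congrArg (fun L : ℝ →L[ℝ] ℝ => L 1) (h3.unique h4)
    simp only [add_apply, sum_apply,
      ContinuousLinearMap.comp_apply, hy, hA0, ContinuousLinearMap.inl_apply, ← hXy,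
      ContinuousAlternatingMap.apply_apply, ContinuousLinearMap.flip_apply,
      ContinuousAlternatingMap.toContinuousLinearMap_apply, zero_apply] at h5
    rw [hXD.fderiv, ← h5]
    simp [hsymm]
  have hcur : HasFDerivAt (fun z => (α z).curryLeft) (curryLeftL E k ∘L fderiv ℝ α y) y := by
    have := HasFDerivAt.comp (𝕜 := ℝ) (F := E [⋀^Fin (k + 1)]→L[ℝ] ℝ)
      (G := E →L[ℝ] E [⋀^Fin k]→L[ℝ] ℝ) y (hasFDerivAt_curryLeft (α y)) hα.hasFDerivAt
    exact this
  have hβ := hcur.clm_apply hXD.differentiableAt.hasFDerivAt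
  ext v
  -- Cartan's formula: in the expansion of `dα (X, v)` the term of index `0` is the derivative of
  -- `α` along `X`. Combined with `hLie`, the remaining terms give `d(i_X α) v = 0`.
  have h0 := congrArg (fun A => A (Matrix.vecCons (X y) v)) hclosed
  simp only [extDeriv, ContinuousAlternatingMap.alternatizeUncurryFin_apply] at h0
  rw [Fin.sum_univ_succ] at h0
  rw [extDeriv, hβ.fderiv, ContinuousAlternatingMap.alternatizeUncurryFin_apply]
  have hL := hLie v
  have hr : ∀ i : Fin (k + 1), Fin.removeNth i.succ (Matrix.vecCons (X y) v) =
      Matrix.vecCons (X y) (Fin.removeNth i v) := fun i => by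
    ext j : 1
    cases j using Fin.cases <;> simp [Fin.removeNth, Matrix.vecCons]
  have hu : ∀ i w, α y (Function.update v i w) =
      (-1) ^ (i : ℕ) • α y (Matrix.vecCons w (i.removeNth v)) := fun i w => by
    rw [← ContinuousAlternatingMap.map_insertNth, Fin.insertNth_removeNth]
  simp [hr, pow_succ] at h0
  simp [hu] at hL
  simp [Finset.sum_add_distrib]
  linarith

end Cartan

/-! ### One-parameter subgroups of the torus -/

/-- The exponential map `ℝ³ → T³`. -/
def torusExp (a : Fin 3 → ℝ) : T3 := (Circle.exp (a 0), Circle.exp (a 1), Circle.exp (a 2))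

theorem torusExp_add (a b : Fin 3 → ℝ) : torusExp (a + b) = torusExp a * torusExp b := by
  simp [torusExp, Circle.exp_add]

@[simp]
theorem torusExp_zero : torusExp 0 = 1 := by
  simp [torusExp]

theorem torusExp_surjective : Function.Surjective torusExp := by
  rintro ⟨x, y, z⟩
  obtain ⟨a, rfl⟩ := Circle.exp_surjective x
  obtain ⟨b, rfl⟩ := Circle.exp_surjective y
  obtain ⟨c, rfl⟩ := Circle.exp_surjective z
  exact ⟨![a, b, c], rfl⟩

theorem contMDiff_torusExp_smul (a : Fin 3 → ℝ) :
    ContMDiff 𝓘(ℝ, ℝ) modelT3 ∞ (fun t : ℝ => torusExp (t • a)) := by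
  have h : ∀ i, ContMDiff 𝓘(ℝ, ℝ) (𝓡 1) ∞ (fun t : ℝ => Circle.exp ((t • a) i)) := fun i =>
    contMDiff_circleExp.comp (contDiff_id.mul contDiff_const).contMDiff
  exact (h 0).prodMk ((h 1).prodMk (h 2))

theorem continuous_torusExp : Continuous torusExp := by
  unfold torusExp
  fun_prop

/-- The unit tangent vector to the circle at the identity. -/
def circleVelocity : EuclideanSpace ℝ (Fin 1) :=
  mfderiv 𝓘(ℝ, ℝ) (𝓡 1) Circle.exp 0 (1 : ℝ)

-- Seen in `ℂ`, the curve `exp (t I)` has velocity `I` at time `0`.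
attribute [local instance] finrank_real_complex_fact' in
theorem circleVelocity_ne_zero : circleVelocity ≠ 0 := by
  intro h0
  have hc : ContMDiff (𝓡 1) 𝓘(ℝ, ℂ) 1 (fun z : Circle => (z : ℂ)) := contMDiff_coe_sphere
  have h1 : mfderiv 𝓘(ℝ, ℝ) 𝓘(ℝ, ℂ) ((fun z : Circle => (z : ℂ)) ∘ Circle.exp) 0 (1 : ℝ) = 0 := by
    have h := mfderiv_comp_apply (I' := 𝓡 1) (0 : ℝ) (hc.mdifferentiableAt (by simp))
      ((contMDiff_circleExp (m := 1)).mdifferentiableAt (by simp)) (1 : ℝ)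
    exact h.trans ((congrArg _ h0).trans (map_zero _))
  have h4 : HasDerivAt ((fun z : Circle => (z : ℂ)) ∘ Circle.exp) Complex.I 0 := by
    have := ((Complex.ofRealCLM.hasDerivAt (x := (0 : ℝ))).mul_const Complex.I).cexp
    simpa [Function.comp_def] using this
  rw [mfderiv_eq_fderiv] at h1
  exact Complex.I_ne_zero (h4.deriv.symm.trans h1)

theorem hasMFDerivAt_circleExp_smul (c : ℝ) :
    HasMFDerivAt 𝓘(ℝ, ℝ) (𝓡 1) (fun t : ℝ => Circle.exp (t * c)) 0
      (ContinuousLinearMap.toSpanSingleton ℝ (c • circleVelocity)) := by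
  have h1 : HasMFDerivAt 𝓘(ℝ, ℝ) 𝓘(ℝ, ℝ) (fun t : ℝ => t * c) 0
      (ContinuousLinearMap.toSpanSingleton ℝ c) := by
    have : HasDerivAt (fun t : ℝ => t * c) c 0 := by
      simpa using (hasDerivAt_id (0 : ℝ)).mul_const c
    exact this.hasFDerivAt.hasMFDerivAt
  let D : ℝ →L[ℝ] EuclideanSpace ℝ (Fin 1) := mfderiv 𝓘(ℝ, ℝ) (𝓡 1) Circle.exp 0
  have h2 : HasMFDerivAt 𝓘(ℝ, ℝ) (𝓡 1) Circle.exp ((0 : ℝ) * c) D := by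
    rw [zero_mul]
    exact ((contMDiff_circleExp (m := 1)).mdifferentiableAt (by simp)).hasMFDerivAt
  refine (HasMFDerivAt.comp (0 : ℝ) h2 h1).congr_mfderiv ?_
  have h3 : D ∘L ContinuousLinearMap.toSpanSingleton ℝ c =
      ContinuousLinearMap.toSpanSingleton ℝ (c • D 1) := by
    refine ContinuousLinearMap.ext_ring ?_
    simp [← map_smul]
  exact h3

/-- Every element of the Lie algebra is the velocity of a one-parameter subgroup. -/
theorem exists_hasMFDerivAt_torusExp (v : lieT3) : ∃ a : Fin 3 → ℝ,
    HasMFDerivAt 𝓘(ℝ, ℝ) modelT3 (fun t : ℝ => torusExp (t • a)) 0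
      (ContinuousLinearMap.toSpanSingleton ℝ v) := by
  obtain ⟨x, y, z⟩ : EuclideanSpace ℝ (Fin 1) × EuclideanSpace ℝ (Fin 1) ×
    EuclideanSpace ℝ (Fin 1) := v
  have hspan := fun w => exists_smul_eq_of_finrank_eq_one (K := ℝ)
    (finrank_euclideanSpace_fin (n := 1)) circleVelocity_ne_zero w
  obtain ⟨a, rfl⟩ := hspan x
  obtain ⟨b, rfl⟩ := hspan y
  obtain ⟨c, rfl⟩ := hspan z
  refine ⟨![a, b, c], ?_⟩
  have key : (ContinuousLinearMap.toSpanSingleton ℝ (a • circleVelocity)).prod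
      ((ContinuousLinearMap.toSpanSingleton ℝ (b • circleVelocity)).prod
        (ContinuousLinearMap.toSpanSingleton ℝ (c • circleVelocity))) =
      ContinuousLinearMap.toSpanSingleton ℝ
        (a • circleVelocity, b • circleVelocity, c • circleVelocity) :=
    ContinuousLinearMap.ext_ring (by simp)
  exact ((hasMFDerivAt_circleExp_smul a).prodMk ((hasMFDerivAt_circleExp_smul b).prodMk
    (hasMFDerivAt_circleExp_smul c))).congr_mfderiv key

/-- Dirichlet's pigeonhole argument by compactness: the multiples `(k / c i₀) • c` modulo `ℤ³` have
two members within `ε` of each other, and `T` is the difference of their times. -/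
theorem exists_near_nonzero_multiple {c : Fin 3 → ℝ} (hc : c ≠ 0) {ε : ℝ} (hε : 0 < ε) :
    ∃ (T : ℝ) (n : Fin 3 → ℤ), n ≠ 0 ∧ ∀ i, |T * c i - n i| < ε := by
  obtain ⟨i₀, hi₀⟩ := Function.ne_iff.1 hc
  let u : ℕ → Fin 3 → ℝ := fun k i => Int.fract (k / c i₀ * c i)
  have hu : ∀ k, u k ∈ Set.Icc (0 : Fin 3 → ℝ) 1 := fun k =>
    ⟨fun i => Int.fract_nonneg _, fun i => (Int.fract_lt_one _).le⟩
  obtain ⟨_, -, ψ, hψ, hlim⟩ := isCompact_Icc.tendsto_subseq hu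
  obtain ⟨N, hN⟩ := Metric.cauchySeq_iff.1 hlim.cauchySeq ε hε
  have hd := (dist_pi_lt_iff hε).1 (hN (N + 1) (by simp) N le_rfl)
  refine ⟨((ψ (N + 1) : ℝ) - ψ N) / c i₀,
    fun i => ⌊ψ (N + 1) / c i₀ * c i⌋ - ⌊ψ N / c i₀ * c i⌋, ?_, fun i => ?_⟩
  · refine Function.ne_iff.2 ⟨i₀, ?_⟩
    simp only [Pi.zero_apply] at hi₀ ⊢
    -- In coordinate `i₀` the multiples are exact integers, so `n i₀` is the nonzero difference of
    -- two terms of the subsequence.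
    rw [div_mul_cancel₀ _ hi₀, div_mul_cancel₀ _ hi₀, Int.floor_natCast, Int.floor_natCast]
    have := hψ (Nat.lt_succ_self N)
    simp only [Nat.succ_eq_add_one] at this
    omega
  · have := hd i
    rw [Real.dist_eq] at this
    convert! this using 2
    simp only [u, Function.comp, Int.fract]
    push_cast
    ring

/-- While all `n i` are even, halve both `T` and `n`. The error halves too, and the sum of the `|n
i|` strictly decreases. An odd entry makes the point with angles `π n i` a nontrivial involution. -/
theorem exists_near_odd_multiple {c : Fin 3 → ℝ} (hc : c ≠ 0) {ε : ℝ} (hε : 0 < ε) :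
    ∃ (T : ℝ) (n : Fin 3 → ℤ), (∃ i, Odd (n i)) ∧ ∀ i, |T * c i - n i| < ε := by
  obtain ⟨T, n, hn, hTn⟩ := exists_near_nonzero_multiple hc hε
  induction hN : ∑ i, (n i).natAbs using Nat.strong_induction_on generalizing T n with
  | _ N ih =>
    by_cases hodd : ∃ i, Odd (n i)
    · exact ⟨T, n, hodd, hTn⟩
    · push Not at hodd
      simp only [Int.not_odd_iff_even] at hodd
      choose m hm using hodd
      have hmn : n = fun i => m i + m i := funext hm
      subst hmn
      have hm0 : m ≠ 0 := by
        rintro rfl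
        exact hn (by ext; simp)
      refine ih (∑ i, (m i).natAbs) ?_ (T / 2) m hm0 (fun i => ?_) rfl
      · rw [← hN]
        obtain ⟨i, hi⟩ := Function.ne_iff.1 hm0
        simp only [Pi.zero_apply] at hi
        exact Finset.sum_lt_sum (fun i _ => by dsimp only; omega) ⟨i, Finset.mem_univ _, by dsimp only; omega⟩
      · have h := hTn i
        push_cast at h
        rw [show T * c i - ((m i : ℝ) + m i) = 2 * (T / 2 * c i - m i) by ring, abs_mul] at h
        norm_num at h
        have := abs_nonneg (T / 2 * c i - m i)
        linarith

theorem circleExp_pi_mul_int (n : ℤ) : Circle.exp (Real.pi * n) * Circle.exp (Real.pi * n) = 1 := by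
  rw [← Circle.exp_add, ← Circle.exp_two_pi_mul_int n]
  congr 1; ring

theorem coe_circleExp_pi_mul_odd {n : ℤ} (hn : Odd n) :
    (Circle.exp (Real.pi * n) : ℂ) = -1 := by
  obtain ⟨k, rfl⟩ := hn
  rw [show Real.pi * ((2 * k + 1 : ℤ) : ℝ) = 2 * Real.pi * k + Real.pi by push_cast; ring,
    Circle.exp_add, Circle.exp_two_pi_mul_int, one_mul, Circle.coe_exp, Complex.exp_pi_mul_I]

/-- The closure of a nontrivial one-parameter subgroup of the torus contains an involution. -/
theorem exists_involution_mem_of_isClosed {K : Set T3} (hK : IsClosed K) {a : Fin 3 → ℝ}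
    (ha : a ≠ 0) (hmem : ∀ t : ℝ, torusExp (t • a) ∈ K) : ∃ g ∈ K, g ≠ 1 ∧ g * g = 1 := by
  choose T n hodd hT using fun m : ℕ =>
    exists_near_odd_multiple ha (Nat.one_div_pos_of_nat (α := ℝ) (n := m))
  let h : ℕ → T3 := fun m => torusExp fun i => Real.pi * n m i
  -- Asking for a coordinate equal to `-1` keeps `H` away from `1` and is a closed condition, so it
  -- survives in the limit.
  let H : Set T3 := {g | g * g = 1} ∩
    ({g | (g.1 : ℂ) = -1} ∪ ({g | (g.2.1 : ℂ) = -1} ∪ {g | (g.2.2 : ℂ) = -1}))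
  have hH : IsClosed H := by
    refine (isClosed_eq (by fun_prop) (by fun_prop)).inter ((isClosed_eq ?_ ?_).union
      ((isClosed_eq ?_ ?_).union (isClosed_eq ?_ ?_))) <;> fun_prop
  have hmemH : ∀ m, h m ∈ H := fun m => by
    refine ⟨?_, ?_⟩
    · simp [h, torusExp, circleExp_pi_mul_int, Prod.ext_iff]
    · obtain ⟨i, hi⟩ := hodd m
      fin_cases i
      · exact Or.inl (coe_circleExp_pi_mul_odd hi)
      · exact Or.inr (Or.inl (coe_circleExp_pi_mul_odd hi))
      · exact Or.inr (Or.inr (coe_circleExp_pi_mul_odd hi))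
  obtain ⟨g, hg, ψ, hψ, hlim⟩ := hH.isCompact.tendsto_subseq hmemH
  refine ⟨g, ?_, ?_, hg.1⟩
  · have hx : Filter.Tendsto (fun m => fun i => Real.pi * (T m * a i - n m i)) Filter.atTop
        (𝓝 (0 : Fin 3 → ℝ)) := by
      refine tendsto_pi_nhds.2 fun i => ?_
      have h0 : Filter.Tendsto (fun m => T m * a i - n m i) Filter.atTop (𝓝 0) :=
        squeeze_zero_norm (fun m => (hT m i).le) tendsto_one_div_add_atTop_nhds_zero_nat
      simpa using h0.const_mul Real.pi
    -- The errors tend to `0`, so the points at times `π T` of the one-parameter subgroup, all in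
    -- `K`, converge to the same limit `g` as the involutions `h`.
    have hk := ((continuous_torusExp.tendsto 0).comp (hx.comp hψ.tendsto_atTop)).mul hlim
    rw [torusExp_zero, one_mul] at hk
    refine hK.mem_of_tendsto hk (Filter.Eventually.of_forall fun m => ?_)
    have : torusExp ((Real.pi * T (ψ m)) • a) ∈ K := hmem _
    convert! this using 1
    simp only [Function.comp, h]
    rw [← torusExp_add]
    congr 1
    ext i
    simp only [Pi.add_apply, Pi.smul_apply, smul_eq_mul]
    ring
  · rintro rfl
    rcases hg.2 with h1 | h1 | h1 <;> simp at h1 <;> norm_num [Complex.ext_iff] at h1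

/-! ### The flow of the action in charts -/

section Chart

variable {M : Type*} [TopologicalSpace M] [ChartedSpace E7 M] [IsManifold (𝓡 7) ∞ M]

/-- The differential of the chart around `x` at the point with coordinates `y`. -/
def chartDeriv (x : M) (y : E7) : E7 →L[ℝ] E7 :=
  mfderiv (𝓡 7) 𝓘(ℝ, E7) (extChartAt (𝓡 7) x) ((extChartAt (𝓡 7) x).symm y)

/-- The differential of the inverse of the chart around `x` at `y`. -/
def chartSymmDeriv (x : M) (y : E7) : E7 →L[ℝ] E7 :=
  mfderiv 𝓘(ℝ, E7) (𝓡 7) (extChartAt (𝓡 7) x).symm y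

theorem hasMFDerivAt_chart {x m : M} (hm : m ∈ (extChartAt (𝓡 7) x).source) :
    HasMFDerivAt (𝓡 7) 𝓘(ℝ, E7) (extChartAt (𝓡 7) x) m
      (mfderiv (𝓡 7) 𝓘(ℝ, E7) (extChartAt (𝓡 7) x) m) :=
  (mdifferentiableAt_extChartAt (by simpa using hm)).hasMFDerivAt

theorem contMDiffAt_chart_symm {x : M} {y : E7} (hy : y ∈ (extChartAt (𝓡 7) x).target) :
    ContMDiffAt 𝓘(ℝ, E7) (𝓡 7) ∞ (extChartAt (𝓡 7) x).symm y :=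
  (contMDiffOn_extChartAt_symm x).contMDiffAt ((isOpen_target_extChartAt x).mem_nhds hy)

theorem hasMFDerivAt_chart_symm {x : M} {y : E7} (hy : y ∈ (extChartAt (𝓡 7) x).target) :
    HasMFDerivAt 𝓘(ℝ, E7) (𝓡 7) (extChartAt (𝓡 7) x).symm y (chartSymmDeriv x y) :=
  ((contMDiffAt_chart_symm hy).mdifferentiableAt (by simp)).hasMFDerivAt

theorem chartSymmDeriv_comp_chartDeriv {x : M} {y : E7} (hy : y ∈ (extChartAt (𝓡 7) x).target) :
    chartSymmDeriv x y ∘L chartDeriv x y = ContinuousLinearMap.id ℝ E7 := by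
  have hm := (extChartAt (𝓡 7) x).map_target hy
  have h1 : HasMFDerivAt 𝓘(ℝ, E7) (𝓡 7) (extChartAt (𝓡 7) x).symm
      (extChartAt (𝓡 7) x ((extChartAt (𝓡 7) x).symm y)) (chartSymmDeriv x y) := by
    rw [(extChartAt (𝓡 7) x).right_inv hy]
    exact hasMFDerivAt_chart_symm hy
  have h2 := HasMFDerivAt.comp _ h1 (hasMFDerivAt_chart hm)
  have h3 : HasMFDerivAt (𝓡 7) (𝓡 7) ((extChartAt (𝓡 7) x).symm ∘ extChartAt (𝓡 7) x)
      ((extChartAt (𝓡 7) x).symm y) (ContinuousLinearMap.id ℝ E7) :=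
    (hasMFDerivAt_id _).congr_of_eventuallyEq (by
      filter_upwards [(isOpen_extChartAt_source x).mem_nhds hm] with z hz
      exact (extChartAt (𝓡 7) x).left_inv hz)
  exact hasMFDerivAt_unique h2 h3

end Chart

section Action

variable {M : Type*} [TopologicalSpace M] [ChartedSpace E7 M] [IsManifold (𝓡 7) ∞ M]
  [MulAction T3 M] [ContMDiffSMul modelT3 (𝓡 7) ∞ T3 M]

/-- The velocity at time `0` of the one-parameter subgroup `t ↦ torusExp (t • a)` is `v`. -/
def HasVelocity (a : Fin 3 → ℝ) (v : lieT3) : Prop :=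
  HasMFDerivAt 𝓘(ℝ, ℝ) modelT3 (fun t : ℝ => torusExp (t • a)) 0
    (ContinuousLinearMap.toSpanSingleton ℝ v)

theorem hasMFDerivAt_smul_left (m : M) :
    HasMFDerivAt modelT3 (𝓡 7) (fun g : T3 => g • m) 1 (infAction m) := by
  have : ContMDiff modelT3 (𝓡 7) ∞ (fun g : T3 => g • m) :=
    contMDiff_id.smul (I := modelT3) contMDiff_const
  exact (this.mdifferentiableAt (by simp)).hasMFDerivAt

theorem contMDiff_smul_const (g : T3) : ContMDiff (𝓡 7) (𝓡 7) ∞ (fun x : M => g • x) :=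
  ContMDiffSMul.contMDiff_const_smul (I := modelT3) g

theorem hasMFDerivAt_smul_const (g : T3) (m : M) :
    HasMFDerivAt (𝓡 7) (𝓡 7) (fun x : M => g • x) m (mfderiv (𝓡 7) (𝓡 7) (fun x : M => g • x) m) :=
  ((contMDiff_smul_const g).mdifferentiableAt (by simp)).hasMFDerivAt

theorem hasMFDerivAt_flow {a : Fin 3 → ℝ} {v : lieT3} (h : HasVelocity a v) (m : M) :
    HasMFDerivAt 𝓘(ℝ, ℝ) (𝓡 7) (fun t : ℝ => torusExp (t • a) • m) 0
      (ContinuousLinearMap.toSpanSingleton ℝ (flowField v m : E7)) := by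
  have h1 : HasMFDerivAt modelT3 (𝓡 7) (fun g : T3 => g • m) (torusExp ((0 : ℝ) • a))
      (infAction m) := by
    rw [zero_smul, torusExp_zero]
    exact hasMFDerivAt_smul_left m
  refine (HasMFDerivAt.comp (0 : ℝ) h1 h).congr_mfderiv ?_
  let L : EuclideanSpace ℝ (Fin 1) × EuclideanSpace ℝ (Fin 1) × EuclideanSpace ℝ (Fin 1) →L[ℝ] E7 :=
    infAction m
  have key : L ∘L ContinuousLinearMap.toSpanSingleton ℝ v =
      ContinuousLinearMap.toSpanSingleton ℝ (L v) :=
    ContinuousLinearMap.ext_ring ((congrArg L (one_smul ℝ v)).trans (one_smul ℝ (L v)).symm)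
  exact key

/-- The fundamental vector fields are invariant. -/
theorem flowField_smul (v : lieT3) (g : T3) (m : M) :
    flowField v (g • m) = mfderiv (𝓡 7) (𝓡 7) (fun x : M => g • x) m (flowField v m) := by
  let D : E7 →L[ℝ] E7 := mfderiv (𝓡 7) (𝓡 7) (fun x : M => g • x) m
  have h1 : HasMFDerivAt (𝓡 7) (𝓡 7) (fun x : M => g • x) ((1 : T3) • m) D := by
    rw [one_smul]
    exact hasMFDerivAt_smul_const g m
  have h2 := HasMFDerivAt.comp (1 : T3) h1 (hasMFDerivAt_smul_left m)
  -- Here commutativity of the torus enters.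
  have h3 : ((fun x : M => g • x) ∘ fun h : T3 => h • m) = fun h : T3 => h • (g • m) := by
    funext h
    simp only [Function.comp, smul_smul, mul_comm]
  rw [h3] at h2
  exact congrArg (fun L => L v) (hasMFDerivAt_unique (hasMFDerivAt_smul_left (g • m)) h2)

/-- The flow of a one-parameter subgroup in the chart around `x`. -/
def chartFlow (a : Fin 3 → ℝ) (x : M) (p : ℝ × E7) : E7 :=
  extChartAt (𝓡 7) x (torusExp (p.1 • a) • (extChartAt (𝓡 7) x).symm p.2)

theorem contDiffAt_chartFlow (a : Fin 3 → ℝ) {x : M} {t : ℝ} {y : E7}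
    (hy : y ∈ (extChartAt (𝓡 7) x).target)
    (ht : torusExp (t • a) • (extChartAt (𝓡 7) x).symm y ∈ (extChartAt (𝓡 7) x).source) :
    ContDiffAt ℝ ∞ (chartFlow a x) (t, y) := by
  rw [← contMDiffAt_iff_contDiffAt]
  have h1 : ContMDiffAt 𝓘(ℝ, ℝ × E7) modelT3 ∞ (fun p : ℝ × E7 => torusExp (p.1 • a)) (t, y) :=
    ((contMDiff_torusExp_smul a).comp contDiff_fst.contMDiff).contMDiffAt
  have h2 : ContMDiffAt 𝓘(ℝ, ℝ × E7) (𝓡 7) ∞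
      (fun p : ℝ × E7 => (extChartAt (𝓡 7) x).symm p.2) (t, y) :=
    ContMDiffAt.comp (t, y) (contMDiffAt_chart_symm hy) contDiff_snd.contMDiff.contMDiffAt
  exact ContMDiffAt.comp (t, y) (contMDiffAt_extChartAt' (by simpa using ht)) (h1.smul h2)

theorem chartFlow_zero (a : Fin 3 → ℝ) {x : M} {y : E7} (hy : y ∈ (extChartAt (𝓡 7) x).target) :
    chartFlow a x (0, y) = y := by
  simp only [chartFlow, zero_smul, torusExp_zero, one_smul, (extChartAt (𝓡 7) x).right_inv hy]

theorem torusExp_zero_smul_mem (a : Fin 3 → ℝ) {x : M} {y : E7}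
    (hy : y ∈ (extChartAt (𝓡 7) x).target) :
    torusExp ((0 : ℝ) • a) • (extChartAt (𝓡 7) x).symm y ∈ (extChartAt (𝓡 7) x).source := by
  rw [zero_smul, torusExp_zero, one_smul]
  exact (extChartAt (𝓡 7) x).map_target hy

theorem fderiv_chartFlow {a : Fin 3 → ℝ} {v : lieT3} (h : HasVelocity a v) {x : M} {y : E7}
    (hy : y ∈ (extChartAt (𝓡 7) x).target) : fderiv ℝ (chartFlow a x) (0, y) (1, 0) =
      chartDeriv x y (flowField v ((extChartAt (𝓡 7) x).symm y)) := by
  have hd := (contDiffAt_chartFlow a hy (torusExp_zero_smul_mem a hy)).differentiableAt (by simp)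
  have h1 : HasFDerivAt (fun t : ℝ => chartFlow a x (t, y))
      (fderiv ℝ (chartFlow a x) (0, y) ∘L ContinuousLinearMap.inl ℝ ℝ E7) 0 :=
    HasFDerivAt.comp (g := chartFlow a x) (0 : ℝ) hd.hasFDerivAt
      (hasFDerivAt_prodMk_left (𝕜 := ℝ) (0 : ℝ) y)
  have h2 : HasMFDerivAt (𝓡 7) 𝓘(ℝ, E7) (extChartAt (𝓡 7) x)
      (torusExp ((0 : ℝ) • a) • (extChartAt (𝓡 7) x).symm y) (chartDeriv x y) := by
    rw [zero_smul, torusExp_zero, one_smul]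
    exact hasMFDerivAt_chart ((extChartAt (𝓡 7) x).map_target hy)
  have h3 := HasMFDerivAt.comp (0 : ℝ) h2 (hasMFDerivAt_flow h ((extChartAt (𝓡 7) x).symm y))
  have h4 := hasMFDerivAt_unique h1.hasMFDerivAt h3
  have h5 := congrArg (fun L : ℝ →L[ℝ] E7 => L 1) h4
  have key : ∀ (L : E7 →L[ℝ] E7) (u : E7),
      (L ∘L ContinuousLinearMap.toSpanSingleton ℝ u) (1 : ℝ) = L u := fun L u => by simp
  exact h5.trans (key _ _)

/-- The chain rule on both sides of the identity that the inverse chart intertwines the flow in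
coordinates with the action on `M`. -/
theorem chartSymmDeriv_fderiv_chartFlow (a : Fin 3 → ℝ) {x : M} {t : ℝ} {y : E7}
    (hy : y ∈ (extChartAt (𝓡 7) x).target)
    (ht : torusExp (t • a) • (extChartAt (𝓡 7) x).symm y ∈ (extChartAt (𝓡 7) x).source) (w : E7) :
    chartSymmDeriv x (chartFlow a x (t, y)) (fderiv ℝ (chartFlow a x) (t, y) (0, w)) =
      mfderiv (𝓡 7) (𝓡 7) (fun m : M => torusExp (t • a) • m) ((extChartAt (𝓡 7) x).symm y)
        (chartSymmDeriv x y w) := by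
  have hd := (contDiffAt_chartFlow a hy ht).differentiableAt (by simp)
  have h1 : HasFDerivAt (fun z : E7 => chartFlow a x (t, z))
      (fderiv ℝ (chartFlow a x) (t, y) ∘L ContinuousLinearMap.inr ℝ ℝ E7) y :=
    hd.hasFDerivAt.comp y (hasFDerivAt_prodMk_right t y)
  have h2 := HasMFDerivAt.comp y (hasMFDerivAt_chart_symm (x := x) (y := chartFlow a x (t, y))
    ((extChartAt (𝓡 7) x).map_source ht)) h1.hasMFDerivAt
  have h3 := HasMFDerivAt.comp y (hasMFDerivAt_smul_const (torusExp (t • a))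
    ((extChartAt (𝓡 7) x).symm y)) (hasMFDerivAt_chart_symm hy)
  have h4 : (extChartAt (𝓡 7) x).symm ∘ (fun z : E7 => chartFlow a x (t, z)) =ᶠ[𝓝 y]
      (fun m : M => torusExp (t • a) • m) ∘ (extChartAt (𝓡 7) x).symm := by
    have hc : ContinuousAt ((fun m : M => torusExp (t • a) • m) ∘ (extChartAt (𝓡 7) x).symm) y :=
      h3.continuousAt
    filter_upwards [hc.preimage_mem_nhds ((isOpen_extChartAt_source x).mem_nhds ht)] with z hz
    exact (extChartAt (𝓡 7) x).left_inv hz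
  exact congrArg (fun L : E7 →L[ℝ] E7 => L w)
    (hasMFDerivAt_unique h2 (h3.congr_of_eventuallyEq h4))

end Action

/-! ### Contraction of invariant forms with fundamental vector fields -/

section Contract

variable {M : Type*} [TopologicalSpace M] [ChartedSpace E7 M] [IsManifold (𝓡 7) ∞ M]
  [MulAction T3 M] [ContMDiffSMul modelT3 (𝓡 7) ∞ T3 M]

theorem DForm.inChart_apply {k : ℕ} (η : DForm M k) (x : M) (y : E7) (u : Fin k → E7) :
    η.inChart x y u = η ((extChartAt (𝓡 7) x).symm y) (fun i => chartSymmDeriv x y (u i)) := rfl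

theorem DForm.inChart_contract {k : ℕ} (η : DForm M (k + 1)) (X : ∀ m : M, TangentSpace (𝓡 7) m)
    {x : M} {y : E7} (hy : y ∈ (extChartAt (𝓡 7) x).target) :
    (DForm.contract X η).inChart x y =
      (η.inChart x y).curryLeft (chartDeriv x y (X ((extChartAt (𝓡 7) x).symm y))) := by
  ext u
  rw [DForm.inChart_apply, ContinuousAlternatingMap.curryLeft_apply_apply, DForm.inChart_apply]
  have h : chartSymmDeriv x y (chartDeriv x y (X ((extChartAt (𝓡 7) x).symm y))) =
      X ((extChartAt (𝓡 7) x).symm y) :=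
    congrArg (fun L : E7 →L[ℝ] E7 => L (X ((extChartAt (𝓡 7) x).symm y)))
      (chartSymmDeriv_comp_chartDeriv hy)
  refine congrArg (η ((extChartAt (𝓡 7) x).symm y)) (funext fun i => ?_)
  cases i using Fin.cases
  · exact h.symm
  · rfl

theorem PreservesForm.apply {k : ℕ} {η : DForm M k} (h : PreservesForm η) (g : T3) (m : M)
    (u : Fin k → TangentSpace (𝓡 7) m) :
    η (g • m) (fun i => mfderiv (𝓡 7) (𝓡 7) (fun x : M => g • x) m (u i)) = η m u :=
  congrArg (fun A => A u) (h g m)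

/-- Contraction with a fundamental vector field preserves invariance. -/
theorem PreservesForm.contract {k : ℕ} {η : DForm M (k + 1)} (h : PreservesForm η) (v : lieT3) :
    PreservesForm (DForm.contract (flowField v) η) := by
  intro g m
  ext u
  refine Eq.trans ?_ (h.apply g m (Matrix.vecCons (flowField v m) u))
  refine congrArg (η (g • m)) (funext fun i => ?_)
  cases i using Fin.cases
  · exact flowField_smul v g m
  · rfl

/-- Invariance of a form, expressed in a chart. -/
theorem PreservesForm.inChart {k : ℕ} {η : DForm M k} (h : PreservesForm η) (a : Fin 3 → ℝ) {x : M}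
    {t : ℝ} {y : E7} (hy : y ∈ (extChartAt (𝓡 7) x).target)
    (ht : torusExp (t • a) • (extChartAt (𝓡 7) x).symm y ∈ (extChartAt (𝓡 7) x).source) :
    (η.inChart x (chartFlow a x (t, y))).compContinuousLinearMap
      (fderiv ℝ (chartFlow a x) (t, y) ∘L ContinuousLinearMap.inr ℝ ℝ E7) = η.inChart x y := by
  ext u
  have h1 : η.inChart x (chartFlow a x (t, y))
      (fun i => fderiv ℝ (chartFlow a x) (t, y) (0, u i)) = η.inChart x y u := by
    rw [DForm.inChart_apply]
    simp only [chartSymmDeriv_fderiv_chartFlow a hy ht]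
    have hm : (extChartAt (𝓡 7) x).symm (chartFlow a x (t, y)) =
        torusExp (t • a) • (extChartAt (𝓡 7) x).symm y := (extChartAt (𝓡 7) x).left_inv ht
    -- All tangent spaces unfold to `E7`. Forgetting the dependence on the point allows the base
    -- point to be rewritten.
    let η' : M → E7 [⋀^Fin k]→L[ℝ] ℝ := η
    refine Eq.trans (congrArg (fun m' => η' m' _) hm) ?_
    exact h.apply (torusExp (t • a)) ((extChartAt (𝓡 7) x).symm y)
      (fun i => chartSymmDeriv x y (u i))
  exact h1

theorem eventually_torusExp_smul_mem (a : Fin 3 → ℝ) {x : M} {y : E7}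
    (hy : y ∈ (extChartAt (𝓡 7) x).target) : ∀ᶠ t in 𝓝 (0 : ℝ),
      torusExp (t • a) • (extChartAt (𝓡 7) x).symm y ∈ (extChartAt (𝓡 7) x).source := by
  have : ContinuousSMul T3 M := ContMDiffSMul.continuousSMul (I := modelT3) (I' := 𝓡 7) ∞
  have hc : Continuous fun t : ℝ => torusExp (t • a) • (extChartAt (𝓡 7) x).symm y :=
    ((contMDiff_torusExp_smul a).continuous).smul continuous_const
  exact hc.continuousAt.preimage_mem_nhds
    ((isOpen_extChartAt_source x).mem_nhds (torusExp_zero_smul_mem a hy))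

/-- Fundamental vector fields are smooth. -/
theorem contDiffOn_chartField (v : lieT3) (x : M) :
    ContDiffOn ℝ ∞ (fun y => chartDeriv x y (flowField v ((extChartAt (𝓡 7) x).symm y)))
      (extChartAt (𝓡 7) x).target := by
  obtain ⟨a, ha⟩ := exists_hasMFDerivAt_torusExp v
  intro y hy
  have h1 : ContDiffAt ℝ ∞ (fun z : E7 => fderiv ℝ (chartFlow a x) (0, z) (1, 0)) y := by
    have h := (contDiffAt_chartFlow a hy (torusExp_zero_smul_mem a hy)).fderiv_right
      (m := ∞) (by simp)
    exact (h.comp y (contDiff_prodMk_right (0 : ℝ)).contDiffAt).clm_apply contDiffAt_const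
  refine (h1.congr_of_eventuallyEq ?_).contDiffWithinAt
  filter_upwards [(isOpen_target_extChartAt x).mem_nhds hy] with z hz
  exact (fderiv_chartFlow ha hz).symm

/-- The contraction of an invariant closed form with a fundamental vector field is closed. -/
theorem DForm.IsClosed.contract {k : ℕ} {η : DForm M (k + 1)} (h : η.IsClosed)
    (hinv : PreservesForm η) (v : lieT3) : (DForm.contract (flowField v) η).IsClosed := by
  have hchart := fun x y (hy : y ∈ (extChartAt (𝓡 7) x).target) =>
    DForm.inChart_contract η (flowField v) hy
  refine ⟨fun x => ?_, fun x y hy => ?_⟩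
  · exact (contDiffOn_curryLeft_apply (h.1 x) (contDiffOn_chartField v x)).congr
      fun y hy => hchart x y hy
  · obtain ⟨a, ha⟩ := exists_hasMFDerivAt_torusExp v
    have hev := (isOpen_target_extChartAt x).mem_nhds hy
    have h1 : (DForm.contract (flowField v) η).inChart x =ᶠ[𝓝 y] fun y =>
        (η.inChart x y).curryLeft (chartDeriv x y (flowField v ((extChartAt (𝓡 7) x).symm y))) := by
      filter_upwards [hev] with z hz using hchart x z hz
    rw [h1.extDeriv_eq]
    refine extDeriv_curryLeft_eq_zero (Ψ := chartFlow a x) (h.1.differentiableAt x hy)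
      (contDiffAt_chartFlow a hy (torusExp_zero_smul_mem a hy)) ?_ ?_ ?_ (h.2 x y hy)
    · filter_upwards [hev] with z hz using chartFlow_zero a hz
    · filter_upwards [hev] with z hz using (fderiv_chartFlow ha hz).symm
    · filter_upwards [eventually_torusExp_smul_mem a hy] with t ht using hinv.inChart a hy ht

end Contract

/-! ### Exactness from the vanishing of the first Betti number -/

section Primitive

variable {M : Type*} [TopologicalSpace M] [ChartedSpace E7 M]

theorem exists_primitive_of_firstBetti_eq_zero (hb : firstBetti M = 0) {η : DForm M 1}
    (hη : η.IsClosed) : ∃ f : M → ℝ, ContMDiff (𝓡 7) 𝓘(ℝ, ℝ) ∞ f ∧ dFun f = η := by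
  have hs : Subsingleton (DeRhamH1 M) := rank_zero_iff.1 hb
  have h0 : (Submodule.Quotient.mk (⟨η, hη⟩ : closedOneForms M) : DeRhamH1 M) = 0 :=
    Subsingleton.elim _ _
  exact (Submodule.Quotient.mk_eq_zero _).1 h0

end Primitive

/-! ### Functions with invariant differential -/

section Invariant

variable {M : Type*} [TopologicalSpace M] [ChartedSpace E7 M] [IsManifold (𝓡 7) ∞ M]
  [MulAction T3 M] [ContMDiffSMul modelT3 (𝓡 7) ∞ T3 M]

theorem exists_hasVelocity (a : Fin 3 → ℝ) : ∃ v : lieT3, HasVelocity a v := by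
  let D : ℝ →L[ℝ] EuclideanSpace ℝ (Fin 1) × EuclideanSpace ℝ (Fin 1) × EuclideanSpace ℝ (Fin 1) :=
    mfderiv 𝓘(ℝ, ℝ) modelT3 (fun t : ℝ => torusExp (t • a)) 0
  have key : D = ContinuousLinearMap.toSpanSingleton ℝ (D 1) :=
    ContinuousLinearMap.ext_ring (one_smul ℝ (D 1)).symm
  exact ⟨D 1, (((contMDiff_torusExp_smul a).mdifferentiableAt (by simp)).hasMFDerivAt).congr_mfderiv
    key⟩

/-- By the group law, the derivative at time `t` is the derivative at time `0` of the flow through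
the moved point. -/
theorem hasDerivAt_comp_flow {f : M → ℝ} (hf : ContMDiff (𝓡 7) 𝓘(ℝ, ℝ) ∞ f) {a : Fin 3 → ℝ}
    {v : lieT3} (h : HasVelocity a v) (m : M) (t : ℝ) :
    HasDerivAt (fun t : ℝ => f (torusExp (t • a) • m))
      (DForm.contract (flowField v) (dFun f) (torusExp (t • a) • m) 0) t := by
  set m' := torusExp (t • a) • m with hm'
  let D : E7 →L[ℝ] ℝ := mfderiv (𝓡 7) 𝓘(ℝ, ℝ) f m'
  have h1 : HasMFDerivAt (𝓡 7) 𝓘(ℝ, ℝ) f (torusExp ((0 : ℝ) • a) • m') D := by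
    rw [zero_smul, torusExp_zero, one_smul]
    exact (hf.mdifferentiableAt (by simp)).hasMFDerivAt
  have h2 : HasFDerivAt (fun s : ℝ => f (torusExp (s • a) • m'))
      (D ∘L ContinuousLinearMap.toSpanSingleton ℝ (flowField v m' : E7)) 0 :=
    (HasMFDerivAt.comp (0 : ℝ) h1 (hasMFDerivAt_flow h m')).hasFDerivAt
  have h3 : HasDerivAt (fun s : ℝ => f (torusExp (s • a) • m')) (D (flowField v m')) (t - t) := by
    rw [sub_self]
    convert! h2.hasDerivAt using 1
    exact (congrArg D (one_smul ℝ (flowField v m' : E7))).symm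
  have h4 := HasDerivAt.comp (h := fun s : ℝ => s - t) t h3 ((hasDerivAt_id t).sub_const t)
  rw [mul_one] at h4
  refine h4.congr_of_eventuallyEq (Filter.Eventually.of_forall fun s => ?_)
  simp only [Function.comp, hm', smul_smul, ← torusExp_add, ← add_smul, sub_add_cancel]

/-- Invariance makes `df(X)` a constant `c` along the flow line, so `f` is affine in time with slope
`c`. Being bounded on the compact torus orbit forces `c = 0`. -/
theorem contract_dFun_flowField_eq_zero {f : M → ℝ} (hf : ContMDiff (𝓡 7) 𝓘(ℝ, ℝ) ∞ f)
    (hinv : PreservesForm (dFun f)) (v : lieT3) (m : M) :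
    DForm.contract (flowField v) (dFun f) m 0 = 0 := by
  obtain ⟨a, ha⟩ := exists_hasMFDerivAt_torusExp v
  have : ContinuousSMul T3 M := ContMDiffSMul.continuousSMul (I := modelT3) (I' := 𝓡 7) ∞
  set c := DForm.contract (flowField v) (dFun f) m 0 with hc
  have hd : ∀ t : ℝ, HasDerivAt (fun t : ℝ => f (torusExp (t • a) • m)) c t := fun t => by
    convert! hasDerivAt_comp_flow hf ha m t using 1
    rw [hc, ← (hinv.contract v).apply (torusExp (t • a)) m 0]
    congr 1
    exact Subsingleton.elim _ _
  have hconst : ∀ t : ℝ, f (torusExp (t • a) • m) = f m + t * c := fun t => by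
    have h := is_const_of_deriv_eq_zero
      (f := fun t : ℝ => f (torusExp (t • a) • m) - t * c)
      (fun t => ((hd t).sub ((hasDerivAt_id t).mul_const c)).differentiableAt)
      (fun t => (((hd t).sub ((hasDerivAt_id t).mul_const c)).deriv).trans (by simp)) t 0
    simp at h
    linarith
  obtain ⟨C, hC⟩ := isCompact_univ.exists_bound_of_continuousOn (f := fun g : T3 => f (g • m))
    (hf.continuous.comp (continuous_id.smul continuous_const)).continuousOn
  by_contra hne
  -- The time is chosen so that `f` would take the value `C + 1`.
  have h1 := hC (torusExp (((C + 1 - f m) / c) • a)) trivial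
  rw [hconst, div_mul_cancel₀ _ hne, Real.norm_eq_abs] at h1
  have := le_abs_self (f m + (C + 1 - f m))
  linarith

/-- A function whose differential is invariant under the torus is itself invariant. -/
theorem apply_smul_eq_of_preservesForm {f : M → ℝ} (hf : ContMDiff (𝓡 7) 𝓘(ℝ, ℝ) ∞ f)
    (hinv : PreservesForm (dFun f)) (g : T3) (m : M) : f (g • m) = f m := by
  obtain ⟨a, rfl⟩ := torusExp_surjective g
  obtain ⟨v, hv⟩ := exists_hasVelocity a
  have h := is_const_of_deriv_eq_zero (f := fun t : ℝ => f (torusExp (t • a) • m))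
    (fun t => (hasDerivAt_comp_flow hf hv m t).differentiableAt)
    (fun t => by
      rw [(hasDerivAt_comp_flow hf hv m t).deriv, contract_dFun_flowField_eq_zero hf hinv]) 1 0
  simpa using h

end Invariant

/-! ### Invariance and closedness of the forms `σ_i` -/

section Sigma

variable {M : Type*} [TopologicalSpace M] [ChartedSpace E7 M] [IsManifold (𝓡 7) ∞ M]
  [MulAction T3 M] [ContMDiffSMul modelT3 (𝓡 7) ∞ T3 M]

theorem preservesForm_sigmaForm {φ : DForm M 3} (hpres : PreservesForm φ)
    (v : Module.Basis (Fin 3) ℝ lieT3) (i : Fin 3) : PreservesForm (sigmaForm φ v i) :=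
  PreservesForm.contract (PreservesForm.contract hpres _) _

theorem isClosed_sigmaForm {φ : DForm M 3} (hφ : φ.IsClosed) (hpres : PreservesForm φ)
    (v : Module.Basis (Fin 3) ℝ lieT3) (i : Fin 3) : (sigmaForm φ v i).IsClosed :=
  (hφ.contract hpres _).contract (PreservesForm.contract hpres _) _

/-- The inner contraction fills the first slot of `φ`, hence the order `i + 2`, `i + 1`. -/
theorem sigmaForm_apply (φ : DForm M 3) (v : Module.Basis (Fin 3) ℝ lieT3) (i : Fin 3) (m : M)
    (u : E7) : sigmaForm φ v i m (fun _ => u) =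
      φ m (![flowField (v (i + 2)) m, flowField (v (i + 1)) m, u] : Fin 3 → E7) := by
  refine congrArg (φ m) (funext fun j => ?_)
  fin_cases j <;> rfl

end Sigma

/-! ### Regular points -/

section Regular

variable {M : Type*} [TopologicalSpace M] [ChartedSpace E7 M] [IsManifold (𝓡 7) ∞ M]
  [MulAction T3 M] [ContMDiffSMul modelT3 (𝓡 7) ∞ T3 M]

theorem mem_regularPoints_iff (v : Module.Basis (Fin 3) ℝ lieT3) (m : M) :
    m ∈ regularPoints M ↔ LinearIndependent ℝ (fun i => (flowField (v i) m : E7)) := by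
  let L : lieT3 →ₗ[ℝ] E7 := (infAction m).toLinearMap
  have hL : (fun i => (flowField (v i) m : E7)) = L ∘ v := rfl
  change Function.Injective L ↔ _
  rw [hL]
  constructor
  · intro h
    exact v.linearIndependent.map' L (LinearMap.ker_eq_bot.2 h)
  · intro h
    rw [← LinearMap.ker_eq_bot, Submodule.eq_bot_iff]
    intro u hu
    have hsum := v.sum_repr u
    have h0 : ∑ i, v.repr u i • (L ∘ v) i = 0 := by
      rw [LinearMap.mem_ker, ← hsum, map_sum] at hu
      simpa using hu
    have := Fintype.linearIndependent_iff.1 h _ h0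
    rw [← hsum]
    simp [this]

/-- In a chart the fundamental fields of a basis are continuous, and linear independence of finitely
many vectors is an open condition. -/
theorem isOpen_regularPoints : IsOpen (regularPoints M) := by
  let v : Module.Basis (Fin 3) ℝ lieT3 := Module.finBasisOfFinrankEq ℝ
    (EuclideanSpace ℝ (Fin 1) × EuclideanSpace ℝ (Fin 1) × EuclideanSpace ℝ (Fin 1)) (by simp)
  rw [isOpen_iff_mem_nhds]
  intro x hx
  let w : E7 → Fin 3 → E7 := fun y i =>
    chartDeriv x y (flowField (v i) ((extChartAt (𝓡 7) x).symm y))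
  have hw : ∀ y ∈ (extChartAt (𝓡 7) x).target,
      (LinearIndependent ℝ (w y) ↔ (extChartAt (𝓡 7) x).symm y ∈ regularPoints M) := by
    intro y hy
    rw [mem_regularPoints_iff v]
    have hinj : Function.Injective (chartDeriv x y) := fun a b hab => by
      have h := chartSymmDeriv_comp_chartDeriv hy
      have ha := congrArg (fun L => L a) h
      have hb := congrArg (fun L => L b) h
      simp only [ContinuousLinearMap.comp_apply, ContinuousLinearMap.id_apply] at ha hb
      rw [← ha, ← hb, hab]
    exact (chartDeriv x y).toLinearMap.linearIndependent_iff (LinearMap.ker_eq_bot.2 hinj)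
  have hcont : ContinuousOn w (extChartAt (𝓡 7) x).target :=
    continuousOn_pi.2 fun i => (contDiffOn_chartField (v i) x).continuousOn
  have hopen := hcont.isOpen_inter_preimage (isOpen_target_extChartAt x)
    (isOpen_setOfPred_linearIndependent (𝕜 := ℝ) (E := E7) (ι := Fin 3))
  have hmem : extChartAt (𝓡 7) x x ∈ (extChartAt (𝓡 7) x).target ∩
      w ⁻¹' {f | LinearIndependent ℝ f} := by
    refine ⟨mem_extChartAt_target x, (hw _ (mem_extChartAt_target x)).2 ?_⟩
    rwa [extChartAt_to_inv]
  filter_upwards [(continuousAt_extChartAt (I := 𝓡 7) x).preimage_mem_nhds (hopen.mem_nhds hmem),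
    extChartAt_source_mem_nhds (I := 𝓡 7) x] with z hz hzs
  have := (hw _ hz.1).1 hz.2
  rwa [(extChartAt (𝓡 7) x).left_inv hzs] at this

variable [T2Space M]

theorem hasMFDerivAt_flow_of_flowField_eq_zero {a : Fin 3 → ℝ} {v : lieT3} (h : HasVelocity a v)
    {m : M} (hm : flowField v m = 0) (t : ℝ) :
    HasMFDerivAt 𝓘(ℝ, ℝ) (𝓡 7) (fun t : ℝ => torusExp (t • a) • m) t (0 : ℝ →L[ℝ] E7) := by
  have h1 : HasMFDerivAt 𝓘(ℝ, ℝ) (𝓡 7) (fun s : ℝ => torusExp (s • a) • m) (t - t)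
      (0 : ℝ →L[ℝ] E7) := by
    rw [sub_self]
    refine (hasMFDerivAt_flow h m).congr_mfderiv ?_
    rw [hm]
    exact ContinuousLinearMap.toSpanSingleton_zero ℝ
  have h2 : HasMFDerivAt 𝓘(ℝ, ℝ) 𝓘(ℝ, ℝ) (fun s : ℝ => s - t) t (ContinuousLinearMap.id ℝ ℝ) :=
    ((hasFDerivAt_id t).sub_const t).hasMFDerivAt
  have h3 := HasMFDerivAt.comp t (hasMFDerivAt_smul_const (torusExp (t • a)) _)
    (HasMFDerivAt.comp (f := fun s : ℝ => s - t) t h1 h2)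
  have h4 : ((fun x : M => torusExp (t • a) • x) ∘
      (fun s : ℝ => torusExp (s • a) • m) ∘ fun s : ℝ => s - t) =
      fun s : ℝ => torusExp (s • a) • m := by
    funext s
    simp only [Function.comp, smul_smul, ← torusExp_add, ← add_smul, add_sub_cancel]
  rw [h4] at h3
  refine h3.congr_mfderiv ?_
  have key : ∀ D : E7 →L[ℝ] E7, D ∘L ((0 : ℝ →L[ℝ] E7) ∘L ContinuousLinearMap.id ℝ ℝ) = 0 :=
    fun D => by simp
  exact key _

/-- A zero of a fundamental vector field is fixed by the corresponding one-parameter subgroup. -/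
theorem torusExp_smul_eq_of_flowField_eq_zero {a : Fin 3 → ℝ} {v : lieT3} (h : HasVelocity a v)
    {m : M} (hm : flowField v m = 0) (t : ℝ) : torusExp (t • a) • m = m := by
  have hd := hasMFDerivAt_flow_of_flowField_eq_zero h hm
  have hcont : Continuous fun t : ℝ => torusExp (t • a) • m :=
    continuous_iff_continuousAt.2 fun t => (hd t).continuousAt
  have h0 : torusExp ((0 : ℝ) • a) • m = m := by rw [zero_smul, torusExp_zero, one_smul]
  obtain ⟨ε, hε, hball⟩ := Metric.isOpen_iff.1
    ((isOpen_extChartAt_source (I := 𝓡 7) m).preimage hcont) 0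
    (by rw [Set.mem_preimage, h0]; exact mem_extChartAt_source m)
  have hsmall : ∀ t ∈ Metric.ball (0 : ℝ) ε, torusExp (t • a) • m = m := by
    intro t ht
    have hF : ∀ s ∈ Metric.ball (0 : ℝ) ε, HasFDerivAt
        (fun s : ℝ => extChartAt (𝓡 7) m (torusExp (s • a) • m)) (0 : ℝ →L[ℝ] E7) s := by
      intro s hs
      have h1 := HasMFDerivAt.comp s (hasMFDerivAt_chart (hball hs)) (hd s)
      have key : ∀ D : E7 →L[ℝ] E7, D ∘L (0 : ℝ →L[ℝ] E7) = 0 := fun D => by simp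
      exact (h1.congr_mfderiv (key _)).hasFDerivAt
    have hc := Metric.isOpen_ball.is_const_of_fderiv_eq_zero (𝕜 := ℝ)
      (convex_ball (0 : ℝ) ε).isPreconnected
      (fun s hs => (hF s hs).differentiableAt.differentiableWithinAt)
      (fun s hs => (hF s hs).fderiv) ht (Metric.mem_ball_self hε)
    rw [h0] at hc
    exact (extChartAt (𝓡 7) m).injOn (hball ht) (mem_extChartAt_source m) hc
  -- The point is fixed for small times only so far; any `t` is `n` steps of the small time `t / n`.
  obtain ⟨n, hn⟩ := exists_nat_gt (|t| / ε)
  have hn0 : (0 : ℝ) < n := lt_of_le_of_lt (by positivity) hn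
  have ht : t / n ∈ Metric.ball (0 : ℝ) ε := by
    rw [mem_ball_zero_iff, Real.norm_eq_abs, abs_div, Nat.abs_cast, div_lt_iff₀ hn0]
    rwa [div_lt_iff₀ hε, mul_comm] at hn
  have hk : ∀ k : ℕ, torusExp ((k * (t / n)) • a) • m = m := by
    intro k
    induction k with
    | zero => simp
    | succ k ih =>
      rw [Nat.cast_succ, add_mul, one_mul, add_smul, torusExp_add, mul_smul, hsmall _ ht, ih]
  have := hk n
  rwa [mul_div_cancel₀ _ hn0.ne'] at this

/-- A kernel vector of the infinitesimal action generates a one-parameter subgroup fixing `m`. The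
stabiliser is closed, so it also contains an involution from the closure of that subgroup. -/
theorem exists_involution_smul_eq {m : M} (hm : m ∉ regularPoints M) :
    ∃ g : T3, g ≠ 1 ∧ g * g = 1 ∧ g • m = m := by
  let L : lieT3 →L[ℝ] E7 := infAction m
  have hinj : ¬ Function.Injective L.toLinearMap := hm
  rw [← LinearMap.ker_eq_bot, Submodule.eq_bot_iff] at hinj
  push Not at hinj
  obtain ⟨v, hv, hv0⟩ := hinj
  obtain ⟨a, ha⟩ := exists_hasMFDerivAt_torusExp v
  have ha0 : a ≠ 0 := by
    rintro rfl
    apply hv0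
    have h1 := (hasMFDerivAt_const (I := 𝓘(ℝ, ℝ)) (I' := modelT3) (1 : T3)
      (0 : ℝ)).congr_of_eventuallyEq (f₁ := fun t : ℝ => torusExp (t • (0 : Fin 3 → ℝ)))
      (Filter.Eventually.of_forall fun t => by simp)
    have h2 := congrArg
      (fun L : ℝ →L[ℝ] EuclideanSpace ℝ (Fin 1) × EuclideanSpace ℝ (Fin 1) ×
        EuclideanSpace ℝ (Fin 1) => L 1) (hasMFDerivAt_unique ha h1)
    exact (one_smul ℝ v).symm.trans h2
  have : ContinuousSMul T3 M := ContMDiffSMul.continuousSMul (I := modelT3) (I' := 𝓡 7) ∞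
  have hK : IsClosed {g : T3 | g • m = m} :=
    isClosed_eq (continuous_id.smul continuous_const) continuous_const
  obtain ⟨g, hg, hg1, hgg⟩ := exists_involution_mem_of_isClosed hK ha0
    fun t => torusExp_smul_eq_of_flowField_eq_zero ha hv t
  exact ⟨g, hg1, hgg, hg⟩

/-- The fixed set has a closed interior. At a limit `p` of interior fixed points the differential of
`g` is the identity, by continuity. The average of the identity and `g` in a chart is then a local
diffeomorphism at `p`, and since `g * g = 1` it takes the same value at `z` and `g • z`. -/
theorem eventually_smul_eq_of_frequently_mem_interior {g : T3} (hg : g * g = 1) {p : M}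
    (hp : ∃ᶠ z in 𝓝 p, z ∈ interior {m : M | g • m = m}) : ∀ᶠ z in 𝓝 p, g • z = z := by
  have hgc : Continuous fun m : M => g • m := (contMDiff_smul_const g).continuous
  have hgp : g • p = p :=
    (isClosed_eq hgc continuous_id).mem_of_frequently_of_tendsto (f := id) (s := {m : M | g • m = m})
      (hp.mono fun z hz => interior_subset hz) Filter.tendsto_id
  set y₀ := extChartAt (𝓡 7) p p with hy₀
  have hy₀t : y₀ ∈ (extChartAt (𝓡 7) p).target := mem_extChartAt_target p
  have hsymm₀ : (extChartAt (𝓡 7) p).symm y₀ = p := extChartAt_to_inv p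
  let G : E7 → E7 := fun y => extChartAt (𝓡 7) p (g • (extChartAt (𝓡 7) p).symm y)
  have hG₀ : G y₀ = y₀ := by simp only [G, hsymm₀, hgp]; rfl
  have hGs : ContDiffAt ℝ ∞ G y₀ := by
    rw [← contMDiffAt_iff_contDiffAt]
    refine ContMDiffAt.comp (I' := 𝓡 7) y₀ (g := extChartAt (𝓡 7) p)
      (contMDiffAt_extChartAt' ?_) (ContMDiffAt.comp (I' := 𝓡 7) y₀ (g := fun m : M => g • m)
        (contMDiff_smul_const g).contMDiffAt (contMDiffAt_chart_symm hy₀t))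
    rw [hsymm₀, hgp]
    exact mem_chart_source E7 p
  have hcs : ContinuousAt (extChartAt (𝓡 7) p).symm y₀ := (contMDiffAt_chart_symm hy₀t).continuousAt
  have hfreq : ∃ᶠ y in 𝓝 y₀, fderiv ℝ G y = ContinuousLinearMap.id ℝ E7 := by
    have h1 : ∃ᶠ y in 𝓝 y₀, (extChartAt (𝓡 7) p).symm y ∈ interior {m : M | g • m = m} := by
      have h2 := hp.and_eventually (extChartAt_source_mem_nhds (I := 𝓡 7) p)
      refine (continuousAt_extChartAt (I := 𝓡 7) p).tendsto.frequently (h2.mono fun z hz => ?_)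
      rw [(extChartAt (𝓡 7) p).left_inv hz.2]
      exact hz.1
    refine (h1.and_eventually ((isOpen_target_extChartAt p).mem_nhds hy₀t)).mono ?_
    rintro y ⟨hy, hyt⟩
    have hev : G =ᶠ[𝓝 y] id := by
      filter_upwards [(contMDiffAt_chart_symm hyt).continuousAt.preimage_mem_nhds
        (isOpen_interior.mem_nhds hy), (isOpen_target_extChartAt p).mem_nhds hyt] with z hz hzt
      have hz' : g • (extChartAt (𝓡 7) p).symm z = (extChartAt (𝓡 7) p).symm z :=
        interior_subset (s := {m : M | g • m = m}) hz
      simp only [G, hz', (extChartAt (𝓡 7) p).right_inv hzt, id]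
    rw [hev.fderiv_eq, fderiv_id]
  have hDG : fderiv ℝ G y₀ = ContinuousLinearMap.id ℝ E7 := by
    have hc : ContinuousAt (fderiv ℝ G) y₀ :=
      (hGs.fderiv_right (m := 0) (by simp)).continuousAt
    exact isClosed_singleton.mem_of_frequently_of_tendsto hfreq hc.tendsto
  have hstrict : HasStrictFDerivAt (fun y => (2⁻¹ : ℝ) • (y + G y))
      ((ContinuousLinearEquiv.refl ℝ E7 : E7 ≃L[ℝ] E7) : E7 →L[ℝ] E7) y₀ := by
    have h1 := hGs.hasStrictFDerivAt (by simp)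
    rw [hDG] at h1
    refine (((hasStrictFDerivAt_id y₀).add h1).const_smul (2⁻¹ : ℝ)).congr_fderiv ?_
    ext1 u
    change (2⁻¹ : ℝ) • (u + u) = u
    rw [← two_smul ℝ u, smul_smul]; norm_num
  let e := hstrict.toOpenPartialHomeomorph
  have he : e.source ∈ 𝓝 y₀ :=
    e.open_source.mem_nhds hstrict.mem_toOpenPartialHomeomorph_source
  have hGe : ∀ᶠ y in 𝓝 y₀, G y ∈ e.source := by
    have : Filter.Tendsto G (𝓝 y₀) (𝓝 y₀) := by
      have := hGs.continuousAt.tendsto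
      rwa [hG₀] at this
    exact this.eventually he
  have hext := (continuousAt_extChartAt (I := 𝓡 7) p).tendsto
  filter_upwards [hext.eventually he, hext.eventually hGe, extChartAt_source_mem_nhds (I := 𝓡 7) p,
    hgc.continuousAt.preimage_mem_nhds (by
      rw [hgp]; exact extChartAt_source_mem_nhds (I := 𝓡 7) p)]
    with z hz1 hz2 hz3 hz4
  have hz5 : G (extChartAt (𝓡 7) p z) = extChartAt (𝓡 7) p (g • z) := by
    simp only [G, (extChartAt (𝓡 7) p).left_inv hz3]
  have hz6 : G (extChartAt (𝓡 7) p (g • z)) = extChartAt (𝓡 7) p z := by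
    simp only [G]
    rw [(extChartAt (𝓡 7) p).left_inv hz4, smul_smul, hg, one_smul]
  rw [hz5] at hz2
  refine (extChartAt (𝓡 7) p).injOn hz4 hz3 (e.injOn hz2 hz1 ?_)
  change (2⁻¹ : ℝ) • (_ + G _) = (2⁻¹ : ℝ) • (_ + G _)
  rw [hz5, hz6, add_comm]

theorem finite_involutions : {g : T3 | g * g = 1}.Finite := by
  have hc : {z : Circle | z * z = 1}.Finite := by
    refine Set.Finite.subset (Set.toFinite {1, Circle.exp Real.pi}) fun z hz => ?_
    have hz' : (z : ℂ) * z = 1 := by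
      rw [← Circle.coe_mul, show z * z = 1 from hz, Circle.coe_one]
    rcases mul_self_eq_one_iff.1 hz' with h | h
    · exact Or.inl (Circle.ext h)
    · exact Or.inr (Circle.ext (by simp [h]))
  refine (hc.prod (hc.prod hc)).subset ?_
  rintro ⟨x, y, z⟩ h
  simpa [Prod.ext_iff] using h

/-- On a connected `M`, a fixed set with nonempty interior would be everything, against
faithfulness. A finite union of closed sets with empty interior has empty interior, so no Baire
argument is needed. -/
theorem dense_regularPoints [FaithfulSMul T3 M] [ConnectedSpace M] : Dense (regularPoints M) := by
  have hclosed : ∀ g : T3, IsClosed {m : M | g • m = m} := fun g =>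
    isClosed_eq (contMDiff_smul_const g).continuous continuous_id
  have hempty : ∀ g : T3, g * g = 1 → g ≠ 1 → interior {m : M | g • m = m} = ∅ := by
    intro g hg hg1
    by_contra hne
    have hclopen : IsClopen (interior {m : M | g • m = m}) := by
      refine ⟨isClosed_of_closure_subset fun p hp => ?_, isOpen_interior⟩
      rw [mem_interior_iff_mem_nhds]
      exact eventually_smul_eq_of_frequently_mem_interior hg (mem_closure_iff_frequently.1 hp)
    have huniv := hclopen.eq_univ (Set.nonempty_iff_ne_empty.2 hne)
    refine hg1 (FaithfulSMul.eq_of_smul_eq_smul (α := M) fun m => ?_)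
    rw [one_smul]
    exact interior_subset (s := {m : M | g • m = m}) (huniv ▸ Set.mem_univ m)
  have hfin : ∀ s : Set T3, s.Finite → (∀ g ∈ s, g * g = 1 ∧ g ≠ 1) →
      interior (⋃ g ∈ s, {m : M | g • m = m}) = ∅ := by
    intro s hs
    induction s, hs using Set.Finite.induction_on with
    | empty => simp
    | @insert g s _ hs ih =>
      intro h
      rw [Set.biUnion_insert, interior_union_isClosed_of_interior_empty (hclosed g)
        (ih fun g' hg' => h g' (Set.mem_insert_of_mem _ hg'))]
      exact hempty g (h g (Set.mem_insert _ _)).1 (h g (Set.mem_insert _ _)).2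
  rw [← compl_compl (regularPoints M), ← interior_eq_empty_iff_dense_compl]
  refine Set.subset_eq_empty (interior_mono fun m hm => ?_)
    (hfin {g : T3 | g * g = 1 ∧ g ≠ 1} (finite_involutions.subset fun g hg => hg.1) fun g hg => hg)
  obtain ⟨g, hg1, hgg, hgm⟩ := exists_involution_smul_eq hm
  exact Set.mem_biUnion (show g ∈ {g : T3 | g * g = 1 ∧ g ≠ 1} from ⟨hgg, hg1⟩) hgm

end Regular

/-! ### Regular level sets -/

/-- Appending vectors of `ℝ⁴` and `ℝ³`. -/
def appendE7 : (Fin 4 → ℝ) × (Fin 3 → ℝ) →ₗ[ℝ] E7 where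
  toFun p := WithLp.toLp 2 (Fin.append p.1 p.2 : Fin (4 + 3) → ℝ)
  map_add' p q := by
    ext j
    refine Fin.addCases (m := 4) (n := 3) (fun i => ?_) (fun i => ?_) j <;> simp
  map_smul' c p := by
    ext j
    refine Fin.addCases (m := 4) (n := 3) (fun i => ?_) (fun i => ?_) j <;> simp

theorem appendE7_apply_natAdd (p : (Fin 4 → ℝ) × (Fin 3 → ℝ)) (i : Fin 3) :
    appendE7 p (Fin.natAdd 4 i : Fin (4 + 3)) = p.2 i :=
  Fin.append_right p.1 p.2 i

theorem appendE7_injective : Function.Injective appendE7 := by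
  rintro ⟨a, b⟩ ⟨a', b'⟩ h
  have h' : Fin.append a b = Fin.append a' b' := congrArg WithLp.ofLp h
  ext i
  · simpa using congrFun h' (Fin.castAdd 3 i)
  · simpa using congrFun h' (Fin.natAdd 4 i)

/-- A surjection `ℝ⁷ → ℝ³` can be completed to an isomorphism of `ℝ⁷`. -/
theorem exists_appendE7_bijective {L : E7 →ₗ[ℝ] (Fin 3 → ℝ)} (hL : Function.Surjective L) :
    ∃ Q : E7 →ₗ[ℝ] (Fin 4 → ℝ), Function.Injective (appendE7 ∘ₗ Q.prod L) := by
  have hdim : Module.finrank ℝ (LinearMap.ker L) = 4 := by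
    have := LinearMap.finrank_range_add_finrank_ker L
    rw [LinearMap.range_eq_top.2 hL, finrank_top] at this
    simp at this
    omega
  let ε : LinearMap.ker L ≃ₗ[ℝ] (Fin 4 → ℝ) := LinearEquiv.ofFinrankEq _ _ (by simp [hdim])
  -- `Q` is injective on the kernel of `L`, so `(Q, L)` is injective on `ℝ⁷`.
  obtain ⟨Q, hQ⟩ := ε.toLinearMap.exists_extend
  refine ⟨Q, ?_⟩
  rw [LinearMap.coe_comp]
  refine appendE7_injective.comp ?_
  rw [← LinearMap.ker_eq_bot, Submodule.eq_bot_iff]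
  intro u hu
  have hu' : Q u = 0 ∧ L u = 0 := Prod.mk_eq_zero.1 hu
  have h1 : ε ⟨u, LinearMap.mem_ker.2 hu'.2⟩ = Q u :=
    (congrArg (fun A => A ⟨u, LinearMap.mem_ker.2 hu'.2⟩) hQ).symm
  exact congrArg Subtype.val ((LinearEquiv.map_eq_zero_iff ε).1 (h1.trans hu'.1))

section LevelSet

variable {M : Type*} [TopologicalSpace M] [ChartedSpace E7 M] [IsManifold (𝓡 7) ∞ M]

/-- Composing a chart with a map that is smooth on its target and has invertible differential at
the base point, and restricting, gives a chart of the maximal atlas. -/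
theorem exists_chart_of_contDiffOn {p : M} {Φ : E7 → E7}
    (hΦ : ContDiffOn ℝ ∞ Φ (chartAt E7 p).target) {A : E7 ≃L[ℝ] E7}
    (hA : HasFDerivAt Φ (A : E7 →L[ℝ] E7) (chartAt E7 p p)) {U : Set M} (hU : IsOpen U)
    (hp : p ∈ U) : ∃ e ∈ IsManifold.maximalAtlas (𝓡 7) ∞ M, p ∈ e.source ∧ e.source ⊆ U ∧
      e.source ⊆ (chartAt E7 p).source ∧ ∀ q, e q = Φ (chartAt E7 p q) := by
  set χ := chartAt E7 p with hχ
  have hp0 : p ∈ χ.source := mem_chart_source E7 p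
  have hy0 : χ p ∈ χ.target := χ.map_source hp0
  have hat : ∀ y ∈ χ.target, ContDiffAt ℝ ∞ Φ y := fun y hy =>
    hΦ.contDiffAt (χ.open_target.mem_nhds hy)
  let e₀ := (hat _ hy0).toOpenPartialHomeomorph Φ hA (by simp)
  -- Restricting to points where the differential of `Φ` is invertible makes the local inverse
  -- smooth throughout its domain, not only at the image of the base point.
  let W : Set E7 := χ.target ∩ fderiv ℝ Φ ⁻¹' Set.range ((↑) : (E7 ≃L[ℝ] E7) → E7 →L[ℝ] E7)
  have hc : ContinuousOn (fderiv ℝ Φ) χ.target := fun y hy =>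
    ((hat y hy).fderiv_right (m := 0) (by simp)).continuousAt.continuousWithinAt
  have hW : IsOpen W := hc.isOpen_inter_preimage χ.open_target ContinuousLinearEquiv.isOpen
  let e₁ := e₀.restrOpen W hW
  have he₁W : e₁.source ⊆ W := fun y hy => hy.2
  let e₂ := χ.trans e₁
  have he₂ : e₂ ∈ IsManifold.maximalAtlas (𝓡 7) ∞ M := by
    refine OpenPartialHomeomorph.mem_maximalAtlas_of_contMDiffOn e₂ ?_ ?_
    · have h1 : ContMDiffOn (𝓡 7) (𝓡 7) ∞ Φ χ.target := hΦ.contMDiffOn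
      refine (h1.comp (contMDiffOn_chart (I := 𝓡 7) (x := p)) fun q hq => χ.map_source hq).mono ?_
      intro q hq
      exact hq.1
    · have h1 : ContMDiffOn (𝓡 7) (𝓡 7) ∞ e₁.symm e₁.target := by
        refine ContDiffOn.contMDiffOn fun y hy => ?_
        obtain ⟨B, hB⟩ := (he₁W (e₁.map_target hy)).2
        have hyt := (he₁W (e₁.map_target hy)).1
        refine (e₁.contDiffAt_symm (f₀' := B) hy ?_ (hat _ hyt)).contDiffWithinAt
        rw [hB]
        exact ((hat _ hyt).differentiableAt (by simp)).hasFDerivAt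
      have h2 : ContMDiffOn (𝓡 7) (𝓡 7) ∞ (χ.symm ∘ e₁.symm) e₁.target :=
        (contMDiffOn_chart_symm (I := 𝓡 7) (x := p)).comp h1 fun y hy =>
          (he₁W (e₁.map_target hy)).1
      exact h2.mono fun y hy => hy.1
  refine ⟨e₂.restr U, restr_mem_maximalAtlas _ he₂ hU, ?_, fun q hq => interior_subset hq.2,
    fun q hq => hq.1.1, fun q => rfl⟩
  rw [OpenPartialHomeomorph.restr_source, hU.interior_eq]
  refine ⟨⟨hp0, ?_, hy0, A, ?_⟩, hp⟩
  · exact (hat _ hy0).mem_toOpenPartialHomeomorph_source hA (by simp)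
  · exact hA.fderiv.symm

/-- A level set of three functions is a `4`-dimensional submanifold near the points where their
differentials are linearly independent. -/
theorem isEmbeddedSubmanifold_levelSet_inter {f : Fin 3 → M → ℝ}
    (hf : ∀ i, ContMDiff (𝓡 7) 𝓘(ℝ, ℝ) ∞ (f i)) (c : Fin 3 → ℝ) {U : Set M} (hU : IsOpen U)
    (h : ∀ p ∈ levelSet f c ∩ U, ∀ a : Fin 3 → ℝ,
      (∀ u : E7, ∑ i, a i * dFun (f i) p (fun _ => u) = 0) → a = 0) :
    IsEmbeddedSubmanifold 4 (levelSet f c ∩ U) := by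
  intro p hp
  set χ := chartAt E7 p with hχ
  have hp0 : p ∈ χ.source := mem_chart_source E7 p
  have hy0 : χ p ∈ χ.target := χ.map_source hp0
  let F : E7 → Fin 3 → ℝ := fun y i => f i (χ.symm y) - c i
  have hF : ContDiffOn ℝ ∞ F χ.target := by
    refine contDiffOn_pi.2 fun i => ?_
    have h1 : ContMDiffOn (𝓡 7) 𝓘(ℝ, ℝ) ∞ (f i ∘ χ.symm) χ.target :=
      (hf i).comp_contMDiffOn (contMDiffOn_chart_symm (I := 𝓡 7) (x := p))
    exact (contMDiffOn_iff_contDiffOn.1 h1).sub contDiffOn_const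
  let L : E7 →L[ℝ] (Fin 3 → ℝ) := fderiv ℝ F (χ p)
  have hFL : HasFDerivAt F L (χ p) :=
    ((hF.contDiffAt (χ.open_target.mem_nhds hy0)).differentiableAt (by simp)).hasFDerivAt
  have hLs : Function.Surjective (L : E7 →ₗ[ℝ] (Fin 3 → ℝ)) := by
    refine surjective_pi_of_forall_sum_eq_zero fun a ha => h p hp a fun u => ?_
    let D : E7 →L[ℝ] E7 := mfderiv (𝓡 7) 𝓘(ℝ, E7) (extChartAt (𝓡 7) p) p
    have key : ∀ i, HasMFDerivAt (𝓡 7) 𝓘(ℝ, ℝ) (f i) p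
        (((ContinuousLinearMap.proj (R := ℝ) (φ := fun _ : Fin 3 => ℝ) i).comp L).comp D) := by
      intro i
      have h1 : HasFDerivAt (fun y => F y i + c i)
          ((ContinuousLinearMap.proj (R := ℝ) (φ := fun _ : Fin 3 => ℝ) i).comp L)
          (extChartAt (𝓡 7) p p) := by
        refine HasFDerivAt.add_const (c i) ?_
        exact hasFDerivAt_pi'.1 hFL i
      refine (h1.hasMFDerivAt.comp p
        (hasMFDerivAt_chart (mem_extChartAt_source p))).congr_of_eventuallyEq ?_
      filter_upwards [χ.open_source.mem_nhds hp0] with q hq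
      change f i q = f i (χ.symm (χ q)) - c i + c i
      rw [χ.left_inv hq, sub_add_cancel]
    rw [← ha (D u)]
    refine Finset.sum_congr rfl fun i _ => congrArg (a i * ·) ?_
    exact congrArg (fun T : E7 →L[ℝ] ℝ => T u) (key i).mfderiv
  obtain ⟨Q, hQ⟩ := exists_appendE7_bijective hLs
  let A : E7 ≃L[ℝ] E7 := (LinearEquiv.ofInjectiveEndo _ hQ).toContinuousLinearEquiv
  -- The last three coordinates of `Φ` are the `f i - c i`, so the level set becomes `ℝ⁴ × 0`. The
  -- map `Q` supplies the other four coordinates.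
  let Φ : E7 → E7 := fun y =>
    appendE7.toContinuousLinearMap (Q.toContinuousLinearMap (y - χ p), F y)
  have hΦ : ContDiffOn ℝ ∞ Φ χ.target :=
    (ContinuousLinearMap.contDiff _).comp_contDiffOn
      (((ContinuousLinearMap.contDiff _).comp (contDiff_id.sub contDiff_const)).contDiffOn.prodMk hF)
  have hA : HasFDerivAt Φ (A : E7 →L[ℝ] E7) (χ p) := by
    have h1 : HasFDerivAt Φ _ (χ p) := (ContinuousLinearMap.hasFDerivAt _).comp (χ p)
      (((ContinuousLinearMap.hasFDerivAt Q.toContinuousLinearMap).comp (χ p)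
        ((hasFDerivAt_id (χ p)).sub_const (χ p))).prodMk hFL)
    refine h1.congr_fderiv ?_
    ext1 u
    rfl
  obtain ⟨e, he, hpe, heU, heχ, heΦ⟩ := exists_chart_of_contDiffOn hΦ hA hU hp.2
  refine ⟨e, he, hpe, fun q hq => ?_⟩
  have hval : ∀ i : Fin 3, (e q : E7) (Fin.natAdd 4 i : Fin (4 + 3)) = f i q - c i := by
    intro i
    rw [heΦ]
    refine (appendE7_apply_natAdd _ i).trans ?_
    change f i (χ.symm (χ q)) - c i = _
    rw [χ.left_inv (heχ hq)]
  constructor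
  · rintro ⟨hq1, -⟩ j hj
    obtain ⟨i, rfl⟩ : ∃ i : Fin 3, j = (Fin.natAdd 4 i : Fin (4 + 3)) :=
      ⟨⟨j - 4, by omega⟩, by ext; simp; omega⟩
    rw [hval, hq1 i, sub_self]
  · intro hj
    refine ⟨fun i => ?_, heU hq⟩
    have := hj (Fin.natAdd 4 i : Fin (4 + 3)) (by simp)
    rw [hval] at this
    exact sub_eq_zero.1 this

end LevelSet

/-! ### Tangent vectors of level sets and the forms `σ_i` in a `G₂`-frame -/

section Levels

variable {M : Type*} [TopologicalSpace M] [ChartedSpace E7 M] [IsManifold (𝓡 7) ∞ M]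

/-- A function which is constant on `S` has zero derivative along the tangent vectors of `S`. -/
theorem dFun_apply_eq_zero_of_isTangentTo {f : M → ℝ} (hf : ContMDiff (𝓡 7) 𝓘(ℝ, ℝ) ∞ f)
    {S : Set M} {c : ℝ} (hS : ∀ q ∈ S, f q = c) {p : M} {u : TangentSpace (𝓡 7) p}
    (hu : IsTangentTo S p u) : dFun f p (fun _ => u) = 0 := by
  obtain ⟨γ, hγ, rfl, hγS, rfl⟩ := hu
  have h1 : HasMFDerivAt 𝓘(ℝ, ℝ) 𝓘(ℝ, ℝ) (f ∘ γ) 0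
      ((mfderiv (𝓡 7) 𝓘(ℝ, ℝ) f (γ 0)).comp (mfderiv 𝓘(ℝ, ℝ) (𝓡 7) γ 0)) :=
    HasMFDerivAt.comp (0 : ℝ) (hf.mdifferentiableAt (by simp)).hasMFDerivAt
      (hγ.mdifferentiableAt (by simp)).hasMFDerivAt
  have h2 : HasMFDerivAt 𝓘(ℝ, ℝ) 𝓘(ℝ, ℝ) (f ∘ γ) 0 (0 : ℝ →L[ℝ] ℝ) := by
    refine HasMFDerivAt.congr_of_eventuallyEq (f := fun _ : ℝ => c)
      (hasMFDerivAt_const c (0 : ℝ)) ?_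
    filter_upwards [hγS] with t ht using hS _ ht
  exact congrArg (fun T : ℝ →L[ℝ] ℝ => T 1) (hasMFDerivAt_unique h1 h2)

theorem phi0_reverse_eq_zero {x y z : E7} (h : phi0 ![z, y, x] = 0) : phi0 ![x, y, z] = 0 := by
  have h1 := phi0.toAlternatingMap.map_swap ![z, y, x] (show (0 : Fin 3) ≠ 2 by decide)
  have h2 : ![z, y, x] ∘ Equiv.swap (0 : Fin 3) 2 = ![x, y, z] := by
    ext1 j
    fin_cases j <;> rfl
  rw [h2] at h1
  exact h1.trans (neg_eq_zero.2 h)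

section Frame

variable [T2Space M] [MulAction T3 M] [ContMDiffSMul modelT3 (𝓡 7) ∞ T3 M] {φ : DForm M 3} {v : Module.Basis (Fin 3) ℝ lieT3} {p : M}
  {σ : TangentSpace (𝓡 7) p ≃L[ℝ] E7}

theorem IsG2Frame.sigmaForm_apply (hσ : IsG2Frame φ p σ) (i : Fin 3) (u : E7) :
    sigmaForm φ v i p (fun _ => u) =
      phi0 ![σ (flowField (v (i + 2)) p), σ (flowField (v (i + 1)) p), σ u] := by
  rw [_root_.sigmaForm_apply, ← hσ]
  change phi0 _ = phi0 _
  congr 1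
  ext1 j
  fin_cases j <;> rfl

theorem linearIndependent_frame_flowField (σ : TangentSpace (𝓡 7) p ≃L[ℝ] E7)
    (hp : p ∈ regularPoints M) : LinearIndependent ℝ fun i => σ (flowField (v i) p) := by
  have key : ∀ T : E7 ≃L[ℝ] E7, ∀ x : Fin 3 → E7, LinearIndependent ℝ x →
      LinearIndependent ℝ fun i => T (x i) := fun T x hx =>
    hx.map' T.toLinearEquiv.toLinearMap (LinearEquiv.ker _)
  exact key σ _ ((mem_regularPoints_iff v p).1 hp)

end Frame

end Levels

end

theorem mainTheorem10 {M : Type*} [TopologicalSpace M] [T2Space M] [SecondCountableTopology M]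
    [ChartedSpace E7 M] [IsManifold (𝓡 7) ∞ M]
    (φ : DForm M 3) (hφ : IsG2Form φ) (hG2 : hφ.IsTorsionFree) (hb : firstBetti M = 0)
    [MulAction T3 M] [ContMDiffSMul modelT3 (𝓡 7) ∞ T3 M] [FaithfulSMul T3 M]
    (hpres : PreservesForm φ) (v : Module.Basis (Fin 3) ℝ lieT3) :
    (∃ f : Fin 3 → M → ℝ, ∀ i, ContMDiff (𝓡 7) 𝓘(ℝ, ℝ) ∞ (f i) ∧ dFun (f i) = sigmaForm φ v i) ∧
    (IsOpen (regularPoints M) ∧ (ConnectedSpace M → Dense (regularPoints M))) ∧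
    (∀ f : Fin 3 → M → ℝ,
      (∀ i, ContMDiff (𝓡 7) 𝓘(ℝ, ℝ) ∞ (f i) ∧ dFun (f i) = sigmaForm φ v i) →
      (∀ (i : Fin 3) (g : T3) (m : M), f i (g • m) = f i m) ∧
      (∀ c : Fin 3 → ℝ,
        hφ.IsCoassociative (levelSet f c ∩ regularPoints M) ∧
        (∀ p ∈ levelSet f c ∩ regularPoints M, ∀ u : Fin 3 → TangentSpace (𝓡 7) p,
          (∀ i, IsTangentTo (levelSet f c ∩ regularPoints M) p (u i)) → φ p u = 0)) ∧
      (Pairwise fun c c' : Fin 3 → ℝ => Disjoint (levelSet f c) (levelSet f c')) ∧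
      (⋃ c, levelSet f c) = Set.univ ∧
      (⋃ c, levelSet f c ∩ regularPoints M) = regularPoints M) := by
  refine ⟨?_, ⟨isOpen_regularPoints, fun _ => dense_regularPoints⟩, fun f hf => ?_⟩
  · choose f hf using fun i =>
      exists_primitive_of_firstBetti_eq_zero hb (isClosed_sigmaForm hG2.closed hpres v i)
    exact ⟨f, hf⟩
  have hinv : ∀ i, PreservesForm (dFun (f i)) := fun i => by
    rw [(hf i).2]
    exact preservesForm_sigmaForm hpres v i
  have hframe : ∀ p, IsG2Frame φ p (hφ.frame p) := fun p => (hφ.exists_frame p).choose_spec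
  have hd : ∀ p i (u : E7), dFun (f i) p (fun _ => u) =
      phi0 ![hφ.frame p (flowField (v (i + 2)) p), hφ.frame p (flowField (v (i + 1)) p),
        hφ.frame p u] := fun p i u => by
    rw [(hf i).2]
    exact (hframe p).sigmaForm_apply i u
  -- As `df_0 = σ_0`, this says `φ(X_2, X_1, X_0) = 0` with indices from `0`: the form `φ` vanishes
  -- on orbit directions.
  have hcon : ∀ p, dFun (f 0) p (fun _ => flowField (v 0) p) = 0 := fun p =>
    contract_dFun_flowField_eq_zero (hf 0).1 (hinv 0) (v 0) p
  have hzero : ∀ p, phi0 ![hφ.frame p (flowField (v 0) p), hφ.frame p (flowField (v 1) p),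
      hφ.frame p (flowField (v 2) p)] = 0 := fun p => by
    have h1 := hd p 0 (flowField (v 0) p)
    rw [hcon, zero_add, zero_add] at h1
    exact phi0_reverse_eq_zero h1.symm
  -- Tangent vectors are killed by each `df_i = σ_i`, so they lie in the 4-space on which `phi0`
  -- vanishes. Both the calibration and `φ|_L = 0` follow from this.
  have htan : ∀ c, ∀ p ∈ levelSet f c ∩ regularPoints M, ∀ u : Fin 3 → TangentSpace (𝓡 7) p,
      (∀ i, IsTangentTo (levelSet f c ∩ regularPoints M) p (u i)) →
      phi0 (fun j => hφ.frame p (u j)) = 0 := fun c p hp u hu =>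
    phi0_eq_zero_of_phi0_pair_eq_zero (linearIndependent_frame_flowField (v := v) (hφ.frame p) hp.2)
      (hzero p) fun i j => (hd p i (u j)).symm.trans
        (dFun_apply_eq_zero_of_isTangentTo (hf i).1 (fun q hq => hq.1 i) (hu j))
  refine ⟨fun i g m => apply_smul_eq_of_preservesForm (hf i).1 (hinv i) g m, fun c => ⟨⟨?_, ?_⟩, ?_⟩,
    ?_, ?_, ?_⟩
  · refine isEmbeddedSubmanifold_levelSet_inter (fun i => (hf i).1) c isOpen_regularPoints ?_
    intro p hp a ha
    refine linearIndependent_phi0_pair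
      (linearIndependent_frame_flowField (v := v) (hφ.frame p) hp.2) fun w => ?_
    obtain ⟨u, rfl⟩ := (hφ.frame p).surjective w
    rw [← ha u]
    exact Finset.sum_congr rfl fun i _ => congrArg (a i * ·) (hd p i u).symm
  · intro p hp e he horth
    refine abs_starPhi0_eq_one (e := fun i => hφ.frame p (e i)) horth fun i j k => ?_
    rw [← htan c p hp ![e i, e j, e k] fun l => by fin_cases l <;> exact he _]
    congr 1
    ext1 l
    fin_cases l <;> rfl
  · intro p hp u hu
    rw [← hframe p]
    exact htan c p hp u hu
  · intro c c' hne
    refine Set.disjoint_left.2 fun m hm hm' => hne (funext fun i => ?_)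
    rw [← hm i, hm' i]
  · exact Set.eq_univ_of_forall fun m => Set.mem_iUnion.2 ⟨fun i => f i m, fun i => rfl⟩
  · refine Set.Subset.antisymm (Set.iUnion_subset fun c => Set.inter_subset_right) fun m hm => ?_
    exact Set.mem_iUnion.2 ⟨fun i => f i m, fun i => rfl, hm⟩
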